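/- Let $M$ be a two-dimensional smooth Riemannian manifold that is complete, connected, orientable and of constant sectional curvature $K\neq 0$, let $\nabla$ be its Levi-Civita connection, extended complex linearly to the complexified tangent bundle $E=\mathbb{C}\otimes_{\mathbb{R}}TM$. For a smooth function $f:U\to\mathbb{C}$ on an open set $U\subseteq M$ let $\nabla^n f$ be the $n$-th covariant derivative, i.e. $\nabla^0 f=f$ and, for sections $Z_1,\dots,Z_n$ of $E$, $$(\nabla^n f)(Z_1,\dots,Z_n)=Z_1\big((\nabla^{n-1}f)(Z_2,\dots,Z_n)\big)-\sum_{j=2}^{n}(\nabla^{n-1}f)(Z_2,\dots,\nabla_{Z_1}Z_j,\dots,Z_n),$$ which is a tensor, complex multilinear at each point. Fix $p\in M$ and an orthonormal basis $(e_1,e_2)$ of $T_pM$. For each $q\in M$ let $(X_1(q),X_2(q))$ be the basis of $T_qM$ obtained from $(e_1,e_2)$ by parallel transport along some (arbitrarily chosen, piecewise $C^1$) curve from $p$ to $q$, and put $$h_+=X_1-\sqrt{-1}\,X_2,\qquad h_-=X_1+\sqrt{-1}\,X_2 .$$ Suppose that $(\nabla^2 f)(h_+,h_-)$ is a multiple of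 $f$ on $U$, i.e. there is $a\in\mathbb{C}$ with $(\nabla^2 f)(h_+,h_-)=a f$ on $U$. Then for every $n\ge 0$ and every choice of signs $\sigma_1,\dots,\sigma_n\in\{+,-\}$ with as many $+$ as $-$, the function $(\nabla^n f)(h_{\sigma_1},\dots,h_{\sigma_n})$ is also a multiple of $f$ on $U$: there is $b\in\mathbb{C}$ with $(\nabla^n f)(h_{\sigma_1},\dots,h_{\sigma_n})=b f$ on $U$. -/

import Mathlib

open Bundle FiberBundle VectorField
open scoped Manifold ContDiff Topology

noncomputable section

section Connection

variable {E : Type*} [NormedAddCommGroup E] [NormedSpace ℝ E]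
  {H : Type*} [TopologicalSpace H] {I : ModelWithCorners ℝ E H}
  {M : Type*} [TopologicalSpace M] [ChartedSpace H M] [IsManifold I ∞ M]

/-- A smooth vector field on `M`. -/
def IsSmoothVectorField (X : Π x : M, TangentSpace I x) : Prop :=
  ContMDiff I I.tangent ∞ (fun x ↦ (⟨x, X x⟩ : TangentBundle I M))

/-- The defining properties of the Levi-Civita connection of a Riemannian manifold: it is a smooth
connection on the tangent bundle, it is compatible with the metric, and it is torsion-free. -/
structure IsLeviCivita [CompleteSpace E] [FiniteDimensional ℝ E]
    [RiemannianBundle (fun x : M ↦ TangentSpace I x)]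
    (cov : CovariantDerivative I E (fun x : M ↦ TangentSpace I x)) : Prop where
  smooth : CovariantDerivative.ContMDiffCovariantDerivative cov ∞
  metric : ∀ (Y Z : Π x : M, TangentSpace I x) (x : M) (v : TangentSpace I x),
    MDifferentiableAt I I.tangent (fun y ↦ (⟨y, Y y⟩ : TangentBundle I M)) x →
    MDifferentiableAt I I.tangent (fun y ↦ (⟨y, Z y⟩ : TangentBundle I M)) x →
    mvfderiv I (fun y ↦ inner ℝ (Y y) (Z y)) x v
      = inner ℝ (cov Y x v) (Z x) + inner ℝ (Y x) (cov Z x v)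
  torsion_free : cov.torsion = 0

/-- The curvature `R(X, Y)Z = ∇_X ∇_Y Z - ∇_Y ∇_X Z - ∇_{[X, Y]} Z` of vector fields.
In Mathlib's argument order, `cov Z x (X x)` is the value of `∇_X Z` at `x`. -/
def curvature (cov : CovariantDerivative I E (fun x : M ↦ TangentSpace I x))
    (X Y Z : Π x : M, TangentSpace I x) (x : M) : TangentSpace I x :=
  cov (fun y ↦ cov Z y (Y y)) x (X x) - cov (fun y ↦ cov Z y (X y)) x (Y x)
    - cov Z x (mlieBracket I X Y x)

/-- The sectional curvature `⟨R(X, Y)Y, X⟩ / (⟨X, X⟩⟨Y, Y⟩ - ⟨X, Y⟩²)` at the point `x`,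
meaningful where `X x` and `Y x` are linearly independent. -/
def sectionalCurvature [RiemannianBundle (fun x : M ↦ TangentSpace I x)]
    (cov : CovariantDerivative I E (fun x : M ↦ TangentSpace I x))
    (X Y : Π x : M, TangentSpace I x) (x : M) : ℝ :=
  inner ℝ (curvature cov X Y Y x) (X x)
    / (inner ℝ (X x) (X x) * inner ℝ (Y x) (Y x) - inner ℝ (X x) (Y x) ^ 2)

/-- All sectional curvatures are equal to `K`. -/
def HasConstantSectionalCurvature [RiemannianBundle (fun x : M ↦ TangentSpace I x)]
    (cov : CovariantDerivative I E (fun x : M ↦ TangentSpace I x)) (K : ℝ) : Prop :=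
  ∀ X Y : Π x : M, TangentSpace I x, IsSmoothVectorField X → IsSmoothVectorField Y →
    ∀ x : M, LinearIndependent ℝ ![X x, Y x] → sectionalCurvature cov X Y x = K

/-- The covariant derivative `D W / dt` of a vector field `W` along a curve `γ`. If
`W = ∑ wᵢ sᵢ ∘ γ` in the local frame `sᵢ` given by the trivialization of the tangent bundle at
`γ t`, then this is `∑ wᵢ'(t) sᵢ + wᵢ(t) ∇_{γ'(t)} sᵢ`; the vector field `extend E (W t)` is the
combination `∑ wᵢ(t) sᵢ` with the constant coefficients `wᵢ(t)`. -/
def covDerivAlong (cov : CovariantDerivative I E (fun x : M ↦ TangentSpace I x))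
    (γ : ℝ → M) (W : Π t : ℝ, TangentSpace I (γ t)) (t : ℝ) : TangentSpace I (γ t) :=
  (trivializationAt E (TangentSpace I) (γ t)).symm (γ t)
      (deriv (fun s : ℝ ↦
        (trivializationAt E (TangentSpace I) (γ t) (⟨γ s, W s⟩ : TangentBundle I M)).2) t)
    + cov (extend E (W t)) (γ t) (mfderiv 𝓘(ℝ, ℝ) I γ t (1 : ℝ))

/-- The vectors `u i` at `q` are obtained from the vectors `e i` at `p` by parallel transport along
one `C¹` curve `γ` from `p` to `q` (the same for all `i`). A piecewise `C¹` curve becomes `C¹` after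
a reparametrization, which does not change the parallel transport along it. -/
inductive IsParallelTransport {ι : Type*}
    (cov : CovariantDerivative I E (fun x : M ↦ TangentSpace I x)) :
    (p q : M) → (ι → TangentSpace I p) → (ι → TangentSpace I q) → Prop
  | intro (γ : ℝ → M) (W : ι → Π t : ℝ, TangentSpace I (γ t))
      (hγ : ContMDiff 𝓘(ℝ, ℝ) I 1 γ)
      (hW : ∀ i, ContMDiff 𝓘(ℝ, ℝ) I.tangent 1
        (fun t : ℝ ↦ (⟨γ t, W i t⟩ : TangentBundle I M)))
      (hpar : ∀ i t, covDerivAlong cov γ (W i) t = 0) :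
      IsParallelTransport cov (γ 0) (γ 1) (fun i ↦ W i 0) (fun i ↦ W i 1)

/-- The function `(∇ⁿ f)(Z₁, …, Zₙ)` for real vector fields `Zᵢ`, by the recursion
`(∇ⁿ f)(Z₁, …, Zₙ) = Z₁((∇ⁿ⁻¹ f)(Z₂, …, Zₙ)) - ∑ⱼ (∇ⁿ⁻¹ f)(Z₂, …, ∇_{Z₁} Zⱼ, …, Zₙ)`. -/
def iterCovDeriv (cov : CovariantDerivative I E (fun x : M ↦ TangentSpace I x)) (f : M → ℂ) :
    (n : ℕ) → (Fin n → Π x : M, TangentSpace I x) → M → ℂ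
  | 0, _ => f
  | n + 1, Z => fun x ↦
      mvfderiv I (iterCovDeriv cov f n (Fin.tail Z)) x (Z 0 x)
        - ∑ j : Fin n, iterCovDeriv cov f n
            (Function.update (Fin.tail Z) j (fun y ↦ cov (Z j.succ) y (Z 0 y))) x

/-- The tensor `∇ⁿ f` at the point `x`, applied to real tangent vectors: its value is that of
`(∇ⁿ f)(Z₁, …, Zₙ)` at `x` for any smooth vector fields `Zᵢ` through the given vectors. -/
def iterCovDerivAt (cov : CovariantDerivative I E (fun x : M ↦ TangentSpace I x)) (f : M → ℂ)
    {n : ℕ} (x : M) (v : Fin n → TangentSpace I x) : ℂ :=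
  iterCovDeriv cov f n (fun i ↦ extend E (v i)) x

/-- A vector `u + √-1 v` of the complexified tangent space `ℂ ⊗ T_x M`, as the pair of its real
part `u` and its imaginary part `v`. -/
@[ext] structure ComplexTangentVector (I : ModelWithCorners ℝ E H) (x : M) where
  re : TangentSpace I x
  im : TangentSpace I x

/-- The tensor `∇ⁿ f` at the point `x`, extended complex multilinearly to complex tangent vectors:
the product of the `reᵢ + √-1 imᵢ` is expanded over the set `S` of places with imaginary part. -/
def complexIterCovDerivAt (cov : CovariantDerivative I E (fun x : M ↦ TangentSpace I x))
    (f : M → ℂ) {n : ℕ} (x : M) (z : Fin n → ComplexTangentVector I x) : ℂ :=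
  ∑ S : Finset (Fin n), Complex.I ^ S.card *
    iterCovDerivAt cov f x (fun i ↦ if i ∈ S then (z i).im else (z i).re)

/-- `h₊ = X₁ - √-1 X₂` (for `true`) and `h₋ = X₁ + √-1 X₂` (for `false`). -/
def hVector {x : M} (X : Fin 2 → TangentSpace I x) : Bool → ComplexTangentVector I x
  | true => ⟨X 0, -X 1⟩
  | false => ⟨X 0, X 1⟩

end Connection

/-- A surface is orientable if it carries a nowhere vanishing smooth `2`-form. -/
def IsOrientableSurface (M : Type*) [TopologicalSpace M]
    [ChartedSpace (EuclideanSpace ℝ (Fin 2)) M] [IsManifold (𝓡 2) ∞ M] : Prop :=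
  ∃ α : Π x : M, TangentSpace (𝓡 2) x →L[ℝ] TangentSpace (𝓡 2) x →L[ℝ] ℝ,
    ContMDiff (𝓡 2)
      ((𝓡 2).prod 𝓘(ℝ, EuclideanSpace ℝ (Fin 2) →L[ℝ] EuclideanSpace ℝ (Fin 2) →L[ℝ] ℝ)) ∞
      (fun x ↦ TotalSpace.mk' (EuclideanSpace ℝ (Fin 2) →L[ℝ] EuclideanSpace ℝ (Fin 2) →L[ℝ] ℝ)
        x (α x)) ∧
    (∀ x v, α x v v = 0) ∧ ∀ x, α x ≠ 0

end

/-! Near a point take an orthonormal frame e₀, e₁ and put h_± = e₀ ∓ √-1 e₁. A metric connection can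
only rotate the frame, so ∇h_± = ±√-1 ω h_± with ω the connection form. Hence the components of ∇ⁿf
in the basis h_± arise by iterating two first-order operators: on a component F of weight k (number
of + minus number of −), D_± F = h_±F − √-1 k ω(h_±) F (`IsOrthonormalFrameOn.iterCovDeriv_eq_sum`).

Since dω is −K times the area form, D_+ D_- − D_- D_+ acts on weight k as the scalar −2kK
(`weightedDeriv_commutator`). This yields a ladder as in the representation theory of sl₂: if D_+
D_- f = a f and L_m is obtained from f by m operators of one sign, then the operator of the other
sign sends L_{m+1} to (a + K m(m+1)) L_m (`weightedDeriv_ladder`). So every word in D_± applied to f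
is a constant times some L_m, where m is the absolute value of the sum of the signs
(`exists_iterWeightedDeriv_eq`); for balanced signs L_0 = f remains. The constant depends on the
signs, a and K, but not on the frame, so a different frame may be used at every point.

Of parallel transport only the orthonormality of X(q) is needed. A local frame can be chosen to
agree with X at the single point q; elsewhere the two bases differ by an orthogonal matrix, possibly
reversing orientation, which leaves the Laplacian (∇²f)(h_+, h_-) unchanged
(`complexIterCovDerivAt_two`). -/

noncomputable section

/-! ### Calculus rules for directional derivatives of vector-valued functions. -/

section DirectionalDerivative

variable {E : Type*} [NormedAddCommGroup E] [NormedSpace ℝ E]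
  {H : Type*} [TopologicalSpace H] {I : ModelWithCorners ℝ E H}
  {M : Type*} [TopologicalSpace M] [ChartedSpace H M]
  {A : Type*} [NormedCommRing A] [NormedAlgebra ℝ A]
  {G : Type*} [NormedAddCommGroup G] [NormedSpace ℝ G]

lemma mvfderiv_mul_apply {f g : M → A} {x : M} (hf : MDifferentiableAt I 𝓘(ℝ, A) f x)
    (hg : MDifferentiableAt I 𝓘(ℝ, A) g x) (v : TangentSpace I x) :
    mvfderiv I (fun y ↦ f y * g y) x v = f x * mvfderiv I g x v + mvfderiv I f x v * g x := by
  have h := (hf.hasMFDerivAt.mul hg.hasMFDerivAt).mfderiv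
  have h2 : mvfderiv I (fun y ↦ f y * g y) x v = mfderiv I 𝓘(ℝ, A) (f * g) x v := rfl
  rw [h2, h, mul_comm (mvfderiv I f x v)]
  rfl

lemma mvfderiv_const_mul_apply {f : M → A} {x : M} (hf : MDifferentiableAt I 𝓘(ℝ, A) f x) (c : A)
    (v : TangentSpace I x) :
    mvfderiv I (fun y ↦ c * f y) x v = c * mvfderiv I f x v := by
  rw [mvfderiv_mul_apply mdifferentiableAt_const hf, mvfderiv_const]
  simp

lemma mvfderiv_sum_apply {ι : Type} (s : Finset ι) {f : ι → M → G} {x : M}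
    (hf : ∀ i ∈ s, MDifferentiableAt I 𝓘(ℝ, G) (f i) x) (v : TangentSpace I x) :
    mvfderiv I (fun y ↦ ∑ i ∈ s, f i y) x v = ∑ i ∈ s, mvfderiv I (f i) x v := by
  have h := (HasMFDerivAt.sum (f := f) (f' := fun i ↦ mvfderiv I (f i) x)
    (fun i hi ↦ (hf i hi).hasMFDerivAt)).mfderiv
  have h2 : mvfderiv I (fun y ↦ ∑ i ∈ s, f i y) x v = (∑ i ∈ s, mvfderiv I (f i) x) v := by
    rw [← h, show (∑ i ∈ s, f i) = fun y ↦ ∑ i ∈ s, f i y by ext; simp]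
    rfl
  rw [h2]
  exact sum_apply _ _ _

lemma mvfderiv_prod_apply {ι : Type} [DecidableEq ι] (s : Finset ι) {f : ι → M → A} {x : M}
    (hf : ∀ i ∈ s, MDifferentiableAt I 𝓘(ℝ, A) (f i) x) (v : TangentSpace I x) :
    mvfderiv I (fun y ↦ ∏ i ∈ s, f i y) x v
      = ∑ i ∈ s, (∏ j ∈ s.erase i, f j x) * mvfderiv I (f i) x v := by
  have h := (HasMFDerivAt.prod (f := f) (f' := fun i ↦ mvfderiv I (f i) x)
    (fun i hi ↦ (hf i hi).hasMFDerivAt)).mfderiv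
  have h2 : mvfderiv I (fun y ↦ ∏ i ∈ s, f i y) x v = mfderiv I 𝓘(ℝ, A) (∏ i ∈ s, f i) x v := by
    rw [show (∏ i ∈ s, f i) = fun y ↦ ∏ i ∈ s, f i y by ext; simp]
    rfl
  rw [h2, h]
  exact sum_apply s (fun i ↦ (∏ j ∈ s.erase i, f j x) • mvfderiv I (f i) x) v

lemma mvfderiv_clm_comp_apply {G' : Type*} [NormedAddCommGroup G'] [NormedSpace ℝ G']
    (L : G →L[ℝ] G') {f : M → G} {x : M}
    (hf : MDifferentiableAt I 𝓘(ℝ, G) f x) (v : TangentSpace I x) :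
    mvfderiv I (fun y ↦ L (f y)) x v = L (mvfderiv I f x v) := by
  have h := (L.hasMFDerivAt (x := f x)).comp x hf.hasMFDerivAt
  have h2 : mvfderiv I (fun y ↦ L (f y)) x v = mfderiv I 𝓘(ℝ, G') (L ∘ f) x v := rfl
  rw [h2, h.mfderiv]
  rfl

lemma Filter.EventuallyEq.mvfderiv_eq {f g : M → G} {x : M} (h : f =ᶠ[𝓝 x] g) :
    mvfderiv I f x = mvfderiv I g x := by
  ext v
  have h2 := congr($(h.mfderiv_eq (I := I) (I' := 𝓘(ℝ, G))) v)
  exact h2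

lemma ContMDiffOn.complex_mul {f g : M → ℂ} {W : Set M}
    (hf : ContMDiffOn I 𝓘(ℝ, ℂ) ∞ f W)
    (hg : ContMDiffOn I 𝓘(ℝ, ℂ) ∞ g W) : ContMDiffOn I 𝓘(ℝ, ℂ) ∞ (fun y ↦ f y * g y) W :=
  (contDiff_fst.mul contDiff_snd :
    ContDiff ℝ ∞ fun p : ℂ × ℂ ↦ p.1 * p.2).contMDiff.comp_contMDiffOn (hf.prodMk_space hg)

variable [IsManifold I ∞ M]

lemma ContMDiffAt.mvfderiv_apply {f : M → G} {X : Π x : M, TangentSpace I x} {x : M}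
    (hf : ContMDiffAt I 𝓘(ℝ, G) ∞ f x)
    (hX : ContMDiffAt I I.tangent ∞ (fun y ↦ (⟨y, X y⟩ : TangentBundle I M)) x) :
    ContMDiffAt I 𝓘(ℝ, G) ∞ (fun y ↦ mvfderiv I f y (X y)) x := by
  have h1 := hf.mfderiv_const (m := ∞) (by simp)
  have h2 : ContMDiffAt I 𝓘(ℝ, G).tangent ∞
      (fun y ↦ (⟨f y, mfderiv I 𝓘(ℝ, G) f y (X y)⟩ : TangentBundle 𝓘(ℝ, G) G)) x :=
    ContMDiffAt.clm_apply_of_inCoordinates h1 hX hf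
  exact (contMDiff_snd_tangentBundle_modelSpace G 𝓘(ℝ, G)).contMDiffAt.comp x h2

end DirectionalDerivative

/-! ### Locally smooth vector fields and the Lie bracket as a commutator. -/

section VectorFields

variable {E : Type*} [NormedAddCommGroup E] [NormedSpace ℝ E]
  {H : Type*} [TopologicalSpace H] {I : ModelWithCorners ℝ E H}
  {M : Type*} [TopologicalSpace M] [ChartedSpace H M] [IsManifold I ∞ M]

/-- A vector field that is smooth on the set `W`. -/
def IsSmoothVectorFieldOn (X : Π x : M, TangentSpace I x) (W : Set M) : Prop :=
  ContMDiffOn I I.tangent ∞ (fun x ↦ (⟨x, X x⟩ : TangentBundle I M)) W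

lemma IsSmoothVectorFieldOn.mono {X : Π x : M, TangentSpace I x} {W W' : Set M}
    (hX : IsSmoothVectorFieldOn X W) (h : W' ⊆ W) : IsSmoothVectorFieldOn X W' :=
  ContMDiffOn.mono hX h

lemma IsSmoothVectorFieldOn.contMDiffAt {X : Π x : M, TangentSpace I x} {W : Set M}
    (hX : IsSmoothVectorFieldOn X W) (hW : IsOpen W) {x : M} (hx : x ∈ W) :
    ContMDiffAt I I.tangent ∞ (fun x ↦ (⟨x, X x⟩ : TangentBundle I M)) x :=
  ContMDiffOn.contMDiffAt hX (hW.mem_nhds hx)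

lemma IsSmoothVectorFieldOn.mdifferentiableAt {X : Π x : M, TangentSpace I x} {W : Set M}
    (hX : IsSmoothVectorFieldOn X W) (hW : IsOpen W) {x : M} (hx : x ∈ W) :
    MDifferentiableAt I I.tangent (fun x ↦ (⟨x, X x⟩ : TangentBundle I M)) x :=
  (hX.contMDiffAt hW hx).mdifferentiableAt (by simp)

lemma IsSmoothVectorField.isSmoothVectorFieldOn {X : Π x : M, TangentSpace I x}
    (hX : IsSmoothVectorField X) (W : Set M) : IsSmoothVectorFieldOn X W :=
  ContMDiff.contMDiffOn hX

lemma ContMDiffOn.mvfderiv_apply {G : Type*} [NormedAddCommGroup G] [NormedSpace ℝ G]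
    {f : M → G} {X : Π x : M, TangentSpace I x} {W : Set M}
    (hf : ContMDiffOn I 𝓘(ℝ, G) ∞ f W) (hX : IsSmoothVectorFieldOn X W) (hW : IsOpen W) :
    ContMDiffOn I 𝓘(ℝ, G) ∞ (fun y ↦ mvfderiv I f y (X y)) W :=
  fun _ hx ↦ ((hf.contMDiffAt (hW.mem_nhds hx)).mvfderiv_apply
    (hX.contMDiffAt hW hx)).contMDiffWithinAt

lemma IsSmoothVectorFieldOn.exists_isSmoothVectorField [T2Space M] [FiniteDimensional ℝ E]
    {X : Π x : M, TangentSpace I x} {W : Set M} (hX : IsSmoothVectorFieldOn X W) (hW : IsOpen W)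
    {x : M} (hx : x ∈ W) :
    ∃ Y : Π x : M, TangentSpace I x, IsSmoothVectorField Y ∧ ∀ᶠ y in 𝓝 x, Y y = X y := by
  obtain ⟨φ, -, hφ⟩ :=
    ((SmoothBumpFunction.nhds_basis_tsupport (I := I) x).mem_iff).1 (hW.mem_nhds hx)
  refine ⟨(φ : M → ℝ) • X,
    ContMDiffOn.smul_section_of_tsupport φ.contMDiff.contMDiffOn hW hφ hX, ?_⟩
  filter_upwards [φ.eventuallyEq_one] with y hy
  simp [hy]

/-- Smoothness of the connection is applied to a global field that agrees with `X` near the given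
point; the covariant derivative is local, so this suffices. -/
lemma IsSmoothVectorFieldOn.covariantDerivative [T2Space M] [FiniteDimensional ℝ E]
    {cov : CovariantDerivative I E (fun x : M ↦ TangentSpace I x)}
    (hcov : CovariantDerivative.ContMDiffCovariantDerivative cov ∞)
    {X Y : Π x : M, TangentSpace I x} {W : Set M} (hW : IsOpen W)
    (hX : IsSmoothVectorFieldOn X W) (hY : IsSmoothVectorFieldOn Y W) :
    IsSmoothVectorFieldOn (fun y ↦ cov X y (Y y)) W := by
  intro x hx
  obtain ⟨X', hX', hXX'⟩ := hX.exists_isSmoothVectorField hW hx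
  have h1 := (hcov.contMDiff.contMDiff (σ := X')
    (ContMDiff.contMDiffOn (by simpa using! hX'))).contMDiffAt Filter.univ_mem (x := x)
  have h2 := h1.clm_bundle_apply (hY.contMDiffAt hW hx)
  refine (h2.congr_of_eventuallyEq ?_).contMDiffWithinAt
  filter_upwards [hXX'.eventually_nhds, hW.mem_nhds hx] with y hy hyW
  have : cov X y = cov X' y :=
    cov.isCovariantDerivativeOn.congr_of_eventuallyEq (hX.mdifferentiableAt hW hyW)
      (hX'.mdifferentiableAt (by simp)) Filter.univ_mem (hy.mono fun _ h ↦ h.symm)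
  rw [this]

/-- The Lie bracket of vector fields acts on functions as the commutator of derivations. -/
lemma mvfderiv_mlieBracket_real [CompleteSpace E]
    {X Y : Π x : M, TangentSpace I x} {f : M → ℝ} {W : Set M} (hW : IsOpen W)
    (hX : IsSmoothVectorFieldOn X W) (hY : IsSmoothVectorFieldOn Y W)
    (hf : ContMDiffOn I 𝓘(ℝ, ℝ) ∞ f W) {x : M} (hx : x ∈ W) :
    mvfderiv I f x (mlieBracket I X Y x)
      = mvfderiv I (fun y ↦ mvfderiv I f y (Y y)) x (X x)
        - mvfderiv I (fun y ↦ mvfderiv I f y (X y)) x (Y x) := by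
  -- Compare the Jacobi identities for (X, Y, fV) and (X, Y, V), where V extends v. After the
  -- Leibniz rule everything cancels except the defect of the claimed formula, multiplied by v.
  have key : ∀ v : TangentSpace I x, (mvfderiv I f x (mlieBracket I X Y x)
      - (mvfderiv I (fun y ↦ mvfderiv I f y (Y y)) x (X x)
        - mvfderiv I (fun y ↦ mvfderiv I f y (X y)) x (Y x))) • v = 0 := by
    intro v
    have : IsManifold I (minSmoothness ℝ 3) M := by
      rw [minSmoothness_of_isRCLikeNormedField]
      exact IsManifold.of_le (n := ∞) ENat.LEInfty.out
    have hV := contMDiffAt_extend (k := ∞) I E v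
    obtain ⟨s, hs, hVs⟩ := exists_contMDiffOn_extend (k := ∞) I E v
    set V := extend E v with hVdef
    have hVx : V x = v := extend_apply_self E v
    have hV' : ∀ᶠ y in 𝓝 x, ContMDiffAt I I.tangent ∞
        (fun x ↦ (⟨x, V x⟩ : TangentBundle I M)) y := by
      filter_upwards [eventually_mem_nhds_iff.2 hs] with y hy
      exact hVs.contMDiffAt hy
    have hWx := hW.mem_nhds hx
    have d : ∀ {Z : Π x : M, TangentSpace I x}, ContMDiffAt I I.tangent 2
        (fun x ↦ (⟨x, Z x⟩ : TangentBundle I M)) x →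
        MDifferentiableAt I I.tangent (fun x ↦ (⟨x, Z x⟩ : TangentBundle I M)) x :=
      fun h ↦ h.mdifferentiableAt (by simp)
    have hfy : ∀ {y}, y ∈ W → ContMDiffAt I 𝓘(ℝ, ℝ) ∞ f y :=
      fun hy ↦ hf.contMDiffAt (hW.mem_nhds hy)
    have two_le : (2 : ℕ∞ω) ≤ ∞ := ENat.LEInfty.out
    have hX2 := (hX.contMDiffAt hW hx).of_le two_le
    have hY2 := (hY.contMDiffAt hW hx).of_le two_le
    have hV2 := hV.of_le two_le
    have hf2 := (hfy hx).of_le two_le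
    have dbr : ∀ {Z Z' : Π x : M, TangentSpace I x},
        ContMDiffAt I I.tangent 2 (fun x ↦ (⟨x, Z x⟩ : TangentBundle I M)) x →
        ContMDiffAt I I.tangent 2 (fun x ↦ (⟨x, Z' x⟩ : TangentBundle I M)) x →
        MDifferentiableAt I I.tangent
          (fun x ↦ (⟨x, mlieBracket I Z Z' x⟩ : TangentBundle I M)) x := by
      intro Z Z' hZ hZ'
      have : IsManifold I ((2 : ℕ∞) + 1) M :=
        IsManifold.of_le (n := ∞) (by exact_mod_cast le_top)
      refine (ContMDiffAt.mlieBracket_vectorField (m := 1) (n := 2) hZ hZ' ?_).mdifferentiableAt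
        (by simp)
      rw [minSmoothness_of_isRCLikeNormedField]
      norm_num
    have inner : ∀ {Z Z' : Π x : M, TangentSpace I x}, IsSmoothVectorFieldOn Z W →
        IsSmoothVectorFieldOn Z' W →
        mlieBracket I Z' (mlieBracket I Z (f • V)) x
          = mvfderiv I (fun y ↦ mvfderiv I f y (Z y)) x (Z' x) • v
            + mvfderiv I f x (Z x) • mlieBracket I Z' V x
            + (mvfderiv I f x (Z' x) • mlieBracket I Z V x
            + f x • mlieBracket I Z' (mlieBracket I Z V) x) := by
      intro Z Z' hZ hZ'
      have hZ2 := (hZ.contMDiffAt hW hx).of_le two_le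
      have e1 : mlieBracket I Z (f • V) =ᶠ[𝓝 x]
          (fun y ↦ mvfderiv I f y (Z y)) • V + f • mlieBracket I Z V := by
        filter_upwards [hV', hWx] with y hy hyW
        exact mlieBracket_smul_right ((hfy hyW).mdifferentiableAt (by simp))
          (hy.mdifferentiableAt (by simp))
      have hdf := ((hf.mvfderiv_apply hZ hW).contMDiffAt hWx).mdifferentiableAt (by simp)
      have hdf' := (hfy hx).mdifferentiableAt (by simp)
      rw [Filter.EventuallyEq.mlieBracket_vectorField_eq (Filter.EventuallyEq.refl _ Z') e1,
        mlieBracket_add_right (hdf.smul_section (d hV2)) (hdf'.smul_section (dbr hZ2 hV2)),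
        mlieBracket_smul_right hdf (d hV2), mlieBracket_smul_right hdf' (dbr hZ2 hV2), hVx]
    have hJ := leibniz_identity_mlieBracket_apply (U := X) (V := Y) (W := f • V) (x := x)
      (by rw [minSmoothness_of_isRCLikeNormedField]; exact hX2)
      (by rw [minSmoothness_of_isRCLikeNormedField]; exact hY2)
      (by rw [minSmoothness_of_isRCLikeNormedField]; exact hf2.smul_section hV2)
    have hJ' := leibniz_identity_mlieBracket_apply (U := X) (V := Y) (W := V) (x := x)
      (by rw [minSmoothness_of_isRCLikeNormedField]; exact hX2)
      (by rw [minSmoothness_of_isRCLikeNormedField]; exact hY2)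
      (by rw [minSmoothness_of_isRCLikeNormedField]; exact hV2)
    rw [inner hY hX, inner hX hY, mlieBracket_smul_right ((hfy hx).mdifferentiableAt (by simp))
      (d hV2), hJ', hVx] at hJ
    rw [sub_smul, sub_smul]
    rw [← neg_eq_zero, ← sub_eq_zero.2 hJ]
    module
  -- A nonzero defect would force the tangent space at `x` to be zero, and then both sides vanish.
  by_contra hne
  have h0 : ∀ v : TangentSpace I x, v = 0 :=
    fun v ↦ (smul_eq_zero.1 (key v)).resolve_left (sub_ne_zero.2 hne)
  rw [h0 (mlieBracket I X Y x), h0 (X x), h0 (Y x)] at hne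
  simp at hne

lemma mvfderiv_mlieBracket [CompleteSpace E]
    {X Y : Π x : M, TangentSpace I x} {f : M → ℂ} {W : Set M} (hW : IsOpen W)
    (hX : IsSmoothVectorFieldOn X W) (hY : IsSmoothVectorFieldOn Y W)
    (hf : ContMDiffOn I 𝓘(ℝ, ℂ) ∞ f W) {x : M} (hx : x ∈ W) :
    mvfderiv I f x (mlieBracket I X Y x)
      = mvfderiv I (fun y ↦ mvfderiv I f y (Y y)) x (X x)
        - mvfderiv I (fun y ↦ mvfderiv I f y (X y)) x (Y x) := by
  have key : ∀ L : ℂ →L[ℝ] ℝ, L (mvfderiv I f x (mlieBracket I X Y x))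
      = L (mvfderiv I (fun y ↦ mvfderiv I f y (Y y)) x (X x)
        - mvfderiv I (fun y ↦ mvfderiv I f y (X y)) x (Y x)) := by
    intro L
    have hL : ContMDiffOn I 𝓘(ℝ, ℝ) ∞ (fun y ↦ L (f y)) W :=
      L.contMDiff.comp_contMDiffOn hf
    have h1 : ∀ {y}, y ∈ W → ∀ v, mvfderiv I (fun y ↦ L (f y)) y v = L (mvfderiv I f y v) :=
      fun hy v ↦ mvfderiv_clm_comp_apply L
        ((hf.contMDiffAt (hW.mem_nhds hy)).mdifferentiableAt (by simp)) v
    have h2 : ∀ {Z : Π x : M, TangentSpace I x}, IsSmoothVectorFieldOn Z W → ∀ v,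
        mvfderiv I (fun y ↦ mvfderiv I (fun y ↦ L (f y)) y (Z y)) x v
          = L (mvfderiv I (fun y ↦ mvfderiv I f y (Z y)) x v) := by
      intro Z hZ v
      rw [← mvfderiv_clm_comp_apply L (((hf.mvfderiv_apply hZ hW).contMDiffAt
        (hW.mem_nhds hx)).mdifferentiableAt (by simp))]
      refine congr($(Filter.EventuallyEq.mvfderiv_eq ?_) v)
      filter_upwards [hW.mem_nhds hx] with y hy
      exact h1 hy _
    have h3 := mvfderiv_mlieBracket_real hW hX hY hL hx
    rw [h1 hx, h2 hX, h2 hY] at h3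
    rw [h3, map_sub]
  exact Complex.ext (key Complex.reCLM) (key Complex.imCLM)

end VectorFields

/-! ### Linear algebra of an orthonormal pair in a plane. -/

section OrthonormalPair

variable {V : Type*} [NormedAddCommGroup V] [InnerProductSpace ℝ V]

lemma orthonormal_fin_two_iff {e : Fin 2 → V} :
    Orthonormal ℝ e ↔ inner ℝ (e 0) (e 0) = 1 ∧ inner ℝ (e 1) (e 1) = 1
      ∧ inner ℝ (e 0) (e 1) = 0 := by
  rw [orthonormal_iff_ite]
  constructor
  · intro h
    exact ⟨by simpa using h 0 0, by simpa using h 1 1, by simpa using h 0 1⟩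
  · rintro ⟨h0, h1, h01⟩ i j
    fin_cases i <;> fin_cases j <;> simp only [Fin.zero_eta, Fin.mk_one] <;> simp
    · simpa using h0
    · exact h01
    · rw [real_inner_comm, h01]
    · simpa using h1

lemma Orthonormal.eq_inner_smul_add_inner_smul {e : Fin 2 → V} (he : Orthonormal ℝ e)
    (hV : Module.finrank ℝ V = 2) (v : V) :
    v = (inner ℝ (e 0) v : ℝ) • e 0 + (inner ℝ (e 1) v : ℝ) • e 1 := by
  have : FiniteDimensional ℝ V := FiniteDimensional.of_finrank_pos (by omega)
  have hspan := he.linearIndependent.span_eq_top_of_card_eq_finrank (by simp [hV])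
  have h := (OrthonormalBasis.mk he hspan.ge).sum_repr' v
  simpa [Fin.sum_univ_two] using h.symm

lemma inner_eq_of_orthonormal {e : Fin 2 → V} (he : Orthonormal ℝ e)
    (hV : Module.finrank ℝ V = 2) (v w : V) :
    (inner ℝ v w : ℝ) = inner ℝ (e 0) v * inner ℝ (e 0) w + inner ℝ (e 1) v * inner ℝ (e 1) w := by
  conv_lhs => rw [he.eq_inner_smul_add_inner_smul hV v]
  simp [inner_add_left, inner_smul_left]

lemma inner_inv_norm_smul_self {v : V} (hv : v ≠ 0) :
    (inner ℝ (‖v‖⁻¹ • v) (‖v‖⁻¹ • v) : ℝ) = 1 := by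
  have h : ‖v‖⁻¹ * ‖v‖ = 1 := inv_mul_cancel₀ (norm_ne_zero_iff.2 hv)
  rw [real_inner_self_eq_norm_sq, norm_smul, norm_inv, norm_norm, h, one_pow]

end OrthonormalPair

/-! ### Smoothness of the canonical local extensions of tangent vectors. -/

section Extend

variable {E : Type*} [NormedAddCommGroup E] [NormedSpace ℝ E]
  {H : Type*} [TopologicalSpace H] {I : ModelWithCorners ℝ E H}
  {M : Type*} [TopologicalSpace M] [ChartedSpace H M] [IsManifold I ∞ M]

/-- The extension has constant coordinates in the trivialization at `q`. -/
lemma isSmoothVectorFieldOn_extend {q : M} (v : TangentSpace I q) :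
    IsSmoothVectorFieldOn (extend E v) (trivializationAt E (TangentSpace I) q).baseSet := by
  set t := trivializationAt E (TangentSpace I) q
  intro x hx
  rw [t.contMDiffWithinAt_section _ hx]
  refine (contMDiffOn_const (c := (t ⟨q, v⟩).2)).congr (fun y hy ↦ ?_) x hx
  change (t ⟨y, t.symm y (t ⟨q, v⟩).2⟩).2 = _
  rw [t.apply_mk_symm hy]

end Extend

/-! ### Local orthonormal frames with a prescribed value at a point. -/

section Frames

variable {E : Type*} [NormedAddCommGroup E] [NormedSpace ℝ E]
  {H : Type*} [TopologicalSpace H] {I : ModelWithCorners ℝ E H}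
  {M : Type*} [TopologicalSpace M] [ChartedSpace H M] [IsManifold I ∞ M]
  [RiemannianBundle (fun x : M ↦ TangentSpace I x)]

/-- A pair of smooth vector fields that is orthonormal on the open set `W`. -/
structure IsOrthonormalFrameOn (e : Fin 2 → Π x : M, TangentSpace I x) (W : Set M) : Prop where
  isOpen : IsOpen W
  smooth : ∀ i, IsSmoothVectorField (e i)
  orthonormal : ∀ x ∈ W, Orthonormal ℝ (fun i ↦ e i x)

lemma IsOrthonormalFrameOn.mono {e : Fin 2 → Π x : M, TangentSpace I x} {W W' : Set M}
    (he : IsOrthonormalFrameOn e W) (hW' : IsOpen W') (h : W' ⊆ W) :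
    IsOrthonormalFrameOn e W' :=
  ⟨hW', he.smooth, fun x hx ↦ he.orthonormal x (h hx)⟩

variable [IsContMDiffRiemannianBundle I ∞ E (fun x : M ↦ TangentSpace I x)]

lemma IsSmoothVectorFieldOn.contMDiffOn_inner {X Y : Π x : M, TangentSpace I x} {W : Set M}
    (hX : IsSmoothVectorFieldOn X W) (hY : IsSmoothVectorFieldOn Y W) :
    ContMDiffOn I 𝓘(ℝ, ℝ) ∞ (fun y ↦ (inner ℝ (X y) (Y y) : ℝ)) W :=
  ContMDiffOn.inner_bundle hX hY

lemma IsSmoothVectorFieldOn.isOpen_ne_zero {X : Π x : M, TangentSpace I x} {W : Set M}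
    (hX : IsSmoothVectorFieldOn X W) (hW : IsOpen W) : IsOpen {x ∈ W | X x ≠ 0} := by
  have h := (hX.contMDiffOn_inner hX).continuousOn.isOpen_inter_preimage hW (isOpen_compl_singleton (x := 0))
  convert h using 1
  ext x
  simp

lemma IsSmoothVectorFieldOn.normalize {X : Π x : M, TangentSpace I x} {W : Set M}
    (hX : IsSmoothVectorFieldOn X W) (h0 : ∀ x ∈ W, X x ≠ 0) :
    IsSmoothVectorFieldOn (fun y ↦ ‖X y‖⁻¹ • X y) W := by
  refine ContMDiffOn.smul_section (f := fun y ↦ ‖X y‖⁻¹) (fun x hx ↦ ?_) hX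
  have h1 : (inner ℝ (X x) (X x) : ℝ) ≠ 0 := by simpa using h0 x hx
  have h2 : ContDiffAt ℝ ∞ (fun t ↦ (√t)⁻¹) (inner ℝ (X x) (X x) : ℝ) :=
    (contDiffAt_id.sqrt h1).inv (by simpa [Real.sqrt_eq_zero', real_inner_self_nonpos] using h0 x hx)
  have h3 := h2.contMDiffAt.comp_contMDiffWithinAt x (hX.contMDiffOn_inner hX x hx)
  exact h3.congr (fun y _ ↦ congr_arg Inv.inv (norm_eq_sqrt_real_inner (X y)))
    (congr_arg Inv.inv (norm_eq_sqrt_real_inner (X x)))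

/-- Gram–Schmidt applied to the extensions of `u 0` and `u 1`, away from the zeros of the fields to
be normalized. The result is then replaced by globally smooth fields with the same germ at `q`,
because the curvature hypothesis speaks of global fields. -/
lemma exists_isOrthonormalFrameOn [T2Space M] [FiniteDimensional ℝ E] {U : Set M} (hU : IsOpen U)
    {q : M} (hq : q ∈ U) {u : Fin 2 → TangentSpace I q} (hu : Orthonormal ℝ u) :
    ∃ (e : Fin 2 → Π x : M, TangentSpace I x) (W : Set M), IsOrthonormalFrameOn e W ∧ q ∈ W ∧
      W ⊆ U ∧ ∀ i, e i q = u i := by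
  obtain ⟨h00, h11, h01⟩ := orthonormal_fin_two_iff.1 hu
  have ext_on := fun v : TangentSpace I q ↦ isSmoothVectorFieldOn_extend v
  set W₀ := (trivializationAt E (TangentSpace I) q).baseSet with hW₀
  have hW₀' : IsOpen W₀ := (trivializationAt E (TangentSpace I) q).open_baseSet
  have hqW₀ : q ∈ W₀ := FiberBundle.mem_baseSet_trivializationAt' q
  have hu0 : ∀ i, u i ≠ 0 := fun i ↦ hu.ne_zero i
  have hun : ∀ i, ‖u i‖ = 1 := fun i ↦ hu.1 i
  set W₁ := {x ∈ W₀ | extend E (u 0) x ≠ 0} with hW₁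
  have hW₁' : IsOpen W₁ := (ext_on _).isOpen_ne_zero hW₀'
  have hqW₁ : q ∈ W₁ := ⟨hqW₀, by simpa using hu0 0⟩
  set a : Π x : M, TangentSpace I x := fun y ↦ ‖extend E (u 0) y‖⁻¹ • extend E (u 0) y with ha
  have haW : IsSmoothVectorFieldOn a W₁ :=
    ((ext_on (u 0)).mono (Set.sep_subset _ _)).normalize fun x hx ↦ hx.2
  have haq : a q = u 0 := by simp [a, hun]
  have haa : ∀ x ∈ W₁, (inner ℝ (a x) (a x) : ℝ) = 1 := by
    exact fun x hx ↦ inner_inv_norm_smul_self hx.2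
  set b : Π x : M, TangentSpace I x :=
    fun y ↦ extend E (u 1) y - (inner ℝ (a y) (extend E (u 1) y) : ℝ) • a y with hb
  have hbW : IsSmoothVectorFieldOn b W₁ :=
    ContMDiffOn.sub_section ((ext_on (u 1)).mono (Set.sep_subset _ _))
      (ContMDiffOn.smul_section (haW.contMDiffOn_inner ((ext_on (u 1)).mono (Set.sep_subset _ _))) haW)
  have hbq : b q = u 1 := by simp [b, haq, h01]
  have hab : ∀ x ∈ W₁, (inner ℝ (a x) (b x) : ℝ) = 0 := by
    intro x hx
    rw [inner_sub_right, inner_smul_right, haa x hx, mul_one, sub_self]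
  set W₂ := {x ∈ W₁ | b x ≠ 0} with hW₂
  have hW₂' : IsOpen W₂ := hbW.isOpen_ne_zero hW₁'
  have hqW₂ : q ∈ W₂ := ⟨hqW₁, by rw [hbq]; exact hu0 1⟩
  set c : Π x : M, TangentSpace I x := fun y ↦ ‖b y‖⁻¹ • b y with hc
  have hcW : IsSmoothVectorFieldOn c W₂ :=
    (hbW.mono (Set.sep_subset _ _)).normalize fun x hx ↦ hx.2
  have hcq : c q = u 1 := by simp [c, hbq, hun]
  obtain ⟨e₀, he₀, he₀a⟩ := (haW.mono (Set.sep_subset _ _)).exists_isSmoothVectorField hW₂' hqW₂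
  obtain ⟨e₁, he₁, he₁c⟩ := hcW.exists_isSmoothVectorField hW₂' hqW₂
  obtain ⟨W, hW, hWo, hqW⟩ := mem_nhds_iff.1
    (Filter.inter_mem (Filter.inter_mem he₀a he₁c) (Filter.inter_mem (hW₂'.mem_nhds hqW₂) (hU.mem_nhds hq)))
  refine ⟨![e₀, e₁], W, ⟨hWo, ?_, fun x hx ↦ ?_⟩, hqW, fun x hx ↦ (hW hx).2.2, ?_⟩
  · intro i
    fin_cases i
    exacts [he₀, he₁]
  · obtain ⟨⟨h0, h1⟩, h2, -⟩ := hW hx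
    refine orthonormal_fin_two_iff.2 ⟨?_, ?_, ?_⟩
    · change inner ℝ (e₀ x) (e₀ x) = 1
      rw [h0, haa x h2.1]
    · change inner ℝ (e₁ x) (e₁ x) = 1
      rw [h1]
      exact inner_inv_norm_smul_self h2.2
    · change inner ℝ (e₀ x) (e₁ x) = 0
      rw [h0, h1]
      simp [c, inner_smul_right, hab x h2.1]
  · intro i
    fin_cases i
    · exact he₀a.self_of_nhds.trans haq
    · exact he₁c.self_of_nhds.trans hcq

end Frames

/-! ### Parallel transport is isometric. -/

/-- The product rule for a family of bilinear forms on a finite-dimensional space that is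
differentiable on constant vectors. -/
lemma hasDerivAt_bilinForm_apply {E : Type*} [NormedAddCommGroup E] [NormedSpace ℝ E]
    [FiniteDimensional ℝ E] {B : ℝ → LinearMap.BilinForm ℝ E} {B' : E → E → ℝ} {v w : ℝ → E}
    {v' w' : E} {t : ℝ} (hB : ∀ a c, HasDerivAt (fun s ↦ B s a c) (B' a c) t)
    (hv : HasDerivAt v v' t) (hw : HasDerivAt w w' t) :
    HasDerivAt (fun s ↦ B s (v s) (w s)) (B' (v t) (w t) + B t v' (w t) + B t (v t) w') t := by
  set b := Module.finBasis ℝ E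
  have expand : ∀ s a c, B s a c = ∑ k, ∑ l, b.repr a k * b.repr c l * B s (b k) (b l) := by
    intro s a c
    conv_lhs => rw [← b.sum_repr a, ← b.sum_repr c]
    simp only [map_sum, map_smul, LinearMap.sum_apply, LinearMap.smul_apply, smul_eq_mul,
      Finset.mul_sum]
    rw [Finset.sum_comm]
    simp only [mul_assoc, mul_left_comm]
  have coord : ∀ (k) {u : ℝ → E} {u' : E}, HasDerivAt u u' t →
      HasDerivAt (fun s ↦ b.repr (u s) k) (b.repr u' k) t := fun k u u' hu ↦
    (LinearMap.toContinuousLinearMap (b.coord k)).hasFDerivAt.comp_hasDerivAt t hu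
  -- `B'` is not assumed bilinear; uniqueness of derivatives gives its expansion in the basis.
  have hconst : B' (v t) (w t)
      = ∑ k, ∑ l, b.repr (v t) k * b.repr (w t) l * B' (b k) (b l) := by
    refine (hB (v t) (w t)).unique ?_
    simp only [expand _ (v t) (w t)]
    exact HasDerivAt.fun_sum fun k _ ↦ HasDerivAt.fun_sum fun l _ ↦
      (hB (b k) (b l)).const_mul _
  rw [hconst, expand t v', expand t (v t)]
  simp only [expand _ (v _) (w _)]
  refine (HasDerivAt.fun_sum fun k (_ : k ∈ Finset.univ) ↦
    HasDerivAt.fun_sum fun l (_ : l ∈ Finset.univ) ↦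
      ((coord k hv).mul (coord l hw)).mul (hB (b k) (b l))).congr_deriv ?_
  simp only [← Finset.sum_add_distrib, Pi.mul_apply]
  refine Finset.sum_congr rfl fun k _ ↦ Finset.sum_congr rfl fun l _ ↦ ?_
  ring

section ParallelTransport

variable {E : Type*} [NormedAddCommGroup E] [NormedSpace ℝ E]
  {H : Type*} [TopologicalSpace H] {I : ModelWithCorners ℝ E H}
  {M : Type*} [TopologicalSpace M] [ChartedSpace H M] [IsManifold I ∞ M]
  [RiemannianBundle (fun x : M ↦ TangentSpace I x)]
  [IsContMDiffRiemannianBundle I ∞ E (fun x : M ↦ TangentSpace I x)]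
  [CompleteSpace E] [FiniteDimensional ℝ E]
  {cov : CovariantDerivative I E (fun x : M ↦ TangentSpace I x)}

/-- The product rule for the inner product of vector fields along a curve. -/
lemma IsLeviCivita.hasDerivAt_inner_along (hcov : IsLeviCivita cov) {γ : ℝ → M}
    {V W : Π t : ℝ, TangentSpace I (γ t)} (hγ : ContMDiff 𝓘(ℝ, ℝ) I 1 γ)
    (hV : ContMDiff 𝓘(ℝ, ℝ) I.tangent 1 (fun t : ℝ ↦ (⟨γ t, V t⟩ : TangentBundle I M)))
    (hW : ContMDiff 𝓘(ℝ, ℝ) I.tangent 1 (fun t : ℝ ↦ (⟨γ t, W t⟩ : TangentBundle I M))) (t : ℝ) :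
    HasDerivAt (fun s ↦ (inner ℝ (V s) (W s) : ℝ))
      (inner ℝ (covDerivAlong cov γ V t) (W t) + inner ℝ (V t) (covDerivAlong cov γ W t)) t := by
  set T := trivializationAt E (TangentSpace I) (γ t) with hT
  have hmem : γ t ∈ T.baseSet := FiberBundle.mem_baseSet_trivializationAt' (γ t)
  -- In the trivialization at `γ t` the inner products of the fibres become bilinear forms `B s` on
  -- the fixed space `E`, and `S a` is the section with constant coordinates `a`.
  let Φ : Π y : M, E →ₗ[ℝ] TangentSpace I y := fun y ↦ T.symmₗ ℝ y
  let B : ℝ → LinearMap.BilinForm ℝ E := fun s ↦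
    (innerₗ (TangentSpace I (γ s))).compl₁₂ (Φ (γ s)) (Φ (γ s))
  let S : E → Π y : M, TangentSpace I y := fun a y ↦ T.symm y a
  have hΦS : ∀ {y}, y ∈ T.baseSet → ∀ a, Φ y a = S a y :=
    fun hy a ↦ congr_fun (T.coe_symmₗ (R := ℝ) hy) a
  -- This identifies `S a` with the kind of field differentiated in `covDerivAlong`.
  have hS : ∀ a : E, S a = extend E (S a (γ t)) := by
    intro a
    funext y
    have : (T ⟨γ t, T.symm (γ t) a⟩).2 = a := by rw [T.apply_mk_symm hmem]
    change T.symm y a = T.symm y (T ⟨γ t, T.symm (γ t) a⟩).2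
    rw [this]
  have repr : ∀ {Z : Π t : ℝ, TangentSpace I (γ t)} {s : ℝ}, γ s ∈ T.baseSet →
      S (T ⟨γ s, Z s⟩).2 (γ s) = Z s := fun hs ↦ T.symm_apply_apply_mk hs _
  have near : ∀ᶠ s in 𝓝 t, γ s ∈ T.baseSet :=
    hγ.continuous.continuousAt.preimage_mem_nhds (T.open_baseSet.mem_nhds hmem)
  have hBS : ∀ {s}, γ s ∈ T.baseSet → ∀ a c, B s a c = (inner ℝ (S a (γ s)) (S c (γ s)) : ℝ) := by
    intro s hs a c
    rw [← hΦS hs, ← hΦS hs]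
    rfl
  have hdiff : ∀ {Z : Π t : ℝ, TangentSpace I (γ t)},
      ContMDiff 𝓘(ℝ, ℝ) I.tangent 1 (fun t : ℝ ↦ (⟨γ t, Z t⟩ : TangentBundle I M)) →
      HasDerivAt (fun s ↦ (T ⟨γ s, Z s⟩).2) (deriv (fun s ↦ (T ⟨γ s, Z s⟩).2) t) t := by
    intro Z hZ
    have h := hZ t
    rw [contMDiffAt_totalSpace] at h
    exact (h.2.contDiffAt.differentiableAt (by simp)).hasDerivAt
  -- Metric compatibility for constant-coordinate sections, and the chain rule along `γ`.
  have hB : ∀ a c : E, HasDerivAt (fun s ↦ B s a c)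
      (inner ℝ (cov (S a) (γ t) (mfderiv 𝓘(ℝ, ℝ) I γ t (1 : ℝ))) (S c (γ t))
        + inner ℝ (S a (γ t)) (cov (S c) (γ t) (mfderiv 𝓘(ℝ, ℝ) I γ t (1 : ℝ)))) t := by
    intro a c
    have hd : ∀ a : E, IsSmoothVectorFieldOn (S a) T.baseSet := by
      intro a
      rw [hS a]
      exact isSmoothVectorFieldOn_extend _
    rw [← hcov.metric _ _ _ _ ((hd a).mdifferentiableAt T.open_baseSet hmem)
      ((hd c).mdifferentiableAt T.open_baseSet hmem)]
    have h1 : MDifferentiableAt I 𝓘(ℝ, ℝ) (fun y ↦ (inner ℝ (S a y) (S c y) : ℝ)) (γ t) :=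
      (((hd a).contMDiffOn_inner (hd c)).contMDiffAt
        (T.open_baseSet.mem_nhds hmem)).mdifferentiableAt (by simp)
    have h2 := h1.hasMFDerivAt.comp t ((hγ t).mdifferentiableAt (by simp)).hasMFDerivAt
    have h3 : HasFDerivAt (fun s ↦ (inner ℝ (S a (γ s)) (S c (γ s)) : ℝ))
      ((mvfderiv I (fun y ↦ (inner ℝ (S a y) (S c y) : ℝ)) (γ t)).comp
        (mfderiv 𝓘(ℝ, ℝ) I γ t) : ℝ →L[ℝ] ℝ) t := h2.hasFDerivAt
    exact h3.hasDerivAt.congr_of_eventuallyEq (near.mono fun s hs ↦ hBS hs a c)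
  have key := hasDerivAt_bilinForm_apply hB (hdiff hV) (hdiff hW)
  have hev : (fun s ↦ (inner ℝ (V s) (W s) : ℝ)) =ᶠ[𝓝 t]
      fun s ↦ B s (T ⟨γ s, V s⟩).2 (T ⟨γ s, W s⟩).2 := by
    filter_upwards [near] with s hs
    rw [hBS hs, repr hs, repr hs]
  refine (key.congr_of_eventuallyEq hev).congr_deriv ?_
  have hcd : ∀ Z : Π t : ℝ, TangentSpace I (γ t), covDerivAlong cov γ Z t
      = S (deriv (fun s ↦ (T ⟨γ s, Z s⟩).2) t) (γ t)
        + cov (extend E (Z t)) (γ t) (mfderiv 𝓘(ℝ, ℝ) I γ t (1 : ℝ)) := fun _ ↦ rfl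
  rw [hBS hmem, hBS hmem, hcd, hcd, hS (T ⟨γ t, V t⟩).2, hS (T ⟨γ t, W t⟩).2, repr hmem, repr hmem,
    extend_apply_self, extend_apply_self, inner_add_left, inner_add_right]
  ring

/-- Parallel transport preserves orthonormality. -/
lemma IsParallelTransport.orthonormal (hcov : IsLeviCivita cov) {ι : Type*} {p q : M}
    {e : ι → TangentSpace I p} {u : ι → TangentSpace I q} (h : IsParallelTransport cov p q e u)
    (he : Orthonormal ℝ e) : Orthonormal ℝ u := by
  classical
  induction h with
  | intro γ W hγ hW hpar =>
    rw [orthonormal_iff_ite] at he ⊢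
    intro i j
    rw [← he i j]
    have hd : ∀ t, HasDerivAt (fun s ↦ (inner ℝ (W i s) (W j s) : ℝ)) 0 t := by
      intro t
      have := hcov.hasDerivAt_inner_along hγ (hW i) (hW j) t
      rwa [hpar, hpar, inner_zero_left, inner_zero_right, add_zero] at this
    exact is_const_of_deriv_eq_zero (fun t ↦ (hd t).differentiableAt) (fun t ↦ (hd t).deriv) 1 0

end ParallelTransport

/-! ### The connection form and the complex components of a frame. -/

section MovingFrame

variable {E : Type*} [NormedAddCommGroup E] [NormedSpace ℝ E]
  {H : Type*} [TopologicalSpace H] {I : ModelWithCorners ℝ E H}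
  {M : Type*} [TopologicalSpace M] [ChartedSpace H M] [IsManifold I ∞ M]
  [RiemannianBundle (fun x : M ↦ TangentSpace I x)]

/-- The connection form of a frame: `∇_v e₀ = ω(v) e₁` and `∇_v e₁ = -ω(v) e₀`. -/
def connectionForm (cov : CovariantDerivative I E (fun x : M ↦ TangentSpace I x))
    (e : Fin 2 → Π x : M, TangentSpace I x) (x : M) (v : TangentSpace I x) : ℝ :=
  inner ℝ (cov (e 0) x v) (e 1 x)

/-- The signs `1` for `true` and `-1` for `false`. -/
def boolSign (b : Bool) : ℤ := if b then 1 else -1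

/-- The coordinates of a tangent vector with respect to the complex basis
`e₀ - √-1 e₁` (for `true`), `e₀ + √-1 e₁` (for `false`). -/
def complexCoord (e : Fin 2 → Π x : M, TangentSpace I x) (b : Bool) (x : M)
    (v : TangentSpace I x) : ℂ :=
  ((inner ℝ (e 0 x) v : ℝ) + boolSign b * Complex.I * (inner ℝ (e 1 x) v : ℝ)) / 2

/-- The covariant derivative, in the direction `e₀ ∓ √-1 e₁`, of the component `F` of weight `k`
of a tensor in the complex basis `e₀ ∓ √-1 e₁`. -/
def weightedDeriv (cov : CovariantDerivative I E (fun x : M ↦ TangentSpace I x))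
    (e : Fin 2 → Π x : M, TangentSpace I x) (b : Bool) (k : ℤ) (F : M → ℂ) (x : M) : ℂ :=
  (mvfderiv I F x (e 0 x) - boolSign b * Complex.I * mvfderiv I F x (e 1 x))
    - Complex.I * k * ((connectionForm cov e x (e 0 x) : ℝ)
      - boolSign b * Complex.I * (connectionForm cov e x (e 1 x) : ℝ)) * F x

/-- The components of `∇ⁿ f` in the complex basis `e₀ ∓ √-1 e₁`. -/
def iterWeightedDeriv (cov : CovariantDerivative I E (fun x : M ↦ TangentSpace I x))
    (e : Fin 2 → Π x : M, TangentSpace I x) (f : M → ℂ) : (n : ℕ) → (Fin n → Bool) → M → ℂ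
  | 0, _ => f
  | n + 1, σ => weightedDeriv cov e (σ 0) (∑ i : Fin n, boolSign (σ i.succ))
      (iterWeightedDeriv cov e f n (Fin.tail σ))

variable {cov : CovariantDerivative I E (fun x : M ↦ TangentSpace I x)}
  {e : Fin 2 → Π x : M, TangentSpace I x} {W : Set M}

lemma connectionForm_add (x : M) (v w : TangentSpace I x) :
    connectionForm cov e x (v + w) = connectionForm cov e x v + connectionForm cov e x w := by
  simp [connectionForm, inner_add_left]

lemma connectionForm_smul (x : M) (r : ℝ) (v : TangentSpace I x) :
    connectionForm cov e x (r • v) = r * connectionForm cov e x v := by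
  simp [connectionForm, inner_smul_left]

lemma IsOrthonormalFrameOn.mdifferentiableAt (he : IsOrthonormalFrameOn e W) (i : Fin 2) (x : M) :
    MDifferentiableAt I I.tangent (fun y ↦ (⟨y, e i y⟩ : TangentBundle I M)) x :=
  (he.smooth i x).mdifferentiableAt (by simp)

lemma IsOrthonormalFrameOn.eq_sum (he : IsOrthonormalFrameOn e W) (hE : Module.finrank ℝ E = 2)
    {x : M} (hx : x ∈ W) (v : TangentSpace I x) :
    v = (inner ℝ (e 0 x) v : ℝ) • e 0 x + (inner ℝ (e 1 x) v : ℝ) • e 1 x :=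
  (he.orthonormal x hx).eq_inner_smul_add_inner_smul hE v

/-- The two coordinates `complexCoord` form the basis dual to e₀ ∓ √-1 e₁, and the weighted
derivative is linear in its direction. -/
lemma IsOrthonormalFrameOn.sum_complexCoord_mul (he : IsOrthonormalFrameOn e W)
    (hE : Module.finrank ℝ E = 2) {x : M} (hx : x ∈ W) (v : TangentSpace I x) (k : ℤ)
    (F : M → ℂ) :
    ∑ b, complexCoord e b x v * weightedDeriv cov e b k F x
      = mvfderiv I F x v - Complex.I * k * connectionForm cov e x v * F x := by
  conv_rhs => rw [he.eq_sum hE hx v]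
  rw [connectionForm_add, connectionForm_smul, connectionForm_smul, map_add, map_smul, map_smul]
  simp only [Fintype.sum_bool, complexCoord, weightedDeriv, boolSign, Complex.real_smul]
  push_cast
  simp
  ring_nf
  simp
  ring

lemma IsOrthonormalFrameOn.contMDiffOn_complexCoord
    [IsContMDiffRiemannianBundle I ∞ E (fun x : M ↦ TangentSpace I x)]
    (he : IsOrthonormalFrameOn e W)
    {Z : Π x : M, TangentSpace I x} (hZ : IsSmoothVectorFieldOn Z W) (b : Bool) :
    ContMDiffOn I 𝓘(ℝ, ℂ) ∞ (fun y ↦ complexCoord e b y (Z y)) W := by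
  have h : ∀ i, ContMDiffOn I 𝓘(ℝ, ℂ) ∞ (fun y ↦ ((inner ℝ (e i y) (Z y) : ℝ) : ℂ)) W := fun i ↦
    Complex.ofRealCLM.contMDiff.comp_contMDiffOn
      (((he.smooth i).isSmoothVectorFieldOn W).contMDiffOn_inner hZ)
  exact ((h 0).add ((contMDiffOn_const (c := boolSign b * Complex.I)).complex_mul
    (h 1))).complex_mul (contMDiffOn_const (c := (2 : ℂ)⁻¹))

variable [CompleteSpace E] [FiniteDimensional ℝ E]

/-- The functions ⟨eᵢ, eⱼ⟩ are constant on `W`, so the connection matrix is skew-symmetric. -/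
lemma IsOrthonormalFrameOn.inner_cov (he : IsOrthonormalFrameOn e W) (hcov : IsLeviCivita cov)
    {x : M} (hx : x ∈ W) (v : TangentSpace I x) (i j : Fin 2) :
    (inner ℝ (cov (e i) x v) (e j x) : ℝ) + inner ℝ (e i x) (cov (e j) x v) = 0 := by
  rw [← hcov.metric _ _ _ _ (he.mdifferentiableAt i x) (he.mdifferentiableAt j x)]
  have h : (fun y ↦ (inner ℝ (e i y) (e j y) : ℝ)) =ᶠ[𝓝 x] fun _ ↦ if i = j then 1 else 0 := by
    filter_upwards [he.isOpen.mem_nhds hx] with y hy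
    exact orthonormal_iff_ite.1 (he.orthonormal y hy) i j
  rw [h.mvfderiv_eq, mvfderiv_const]
  rfl

lemma IsOrthonormalFrameOn.cov_zero (he : IsOrthonormalFrameOn e W) (hcov : IsLeviCivita cov)
    (hE : Module.finrank ℝ E = 2) {x : M} (hx : x ∈ W) (v : TangentSpace I x) :
    cov (e 0) x v = connectionForm cov e x v • e 1 x := by
  have h0 := he.inner_cov hcov hx v 0 0
  have hc := real_inner_comm (cov (e 0) x v) (e 0 x)
  rw [he.eq_sum hE hx (cov (e 0) x v), show (inner ℝ (e 0 x) (cov (e 0) x v) : ℝ) = 0 by linarith,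
    zero_smul, zero_add, real_inner_comm]
  rfl

lemma IsOrthonormalFrameOn.cov_one (he : IsOrthonormalFrameOn e W) (hcov : IsLeviCivita cov)
    (hE : Module.finrank ℝ E = 2) {x : M} (hx : x ∈ W) (v : TangentSpace I x) :
    cov (e 1) x v = -connectionForm cov e x v • e 0 x := by
  have h0 := he.inner_cov hcov hx v 1 1
  have hc := real_inner_comm (cov (e 1) x v) (e 1 x)
  have h1 := he.inner_cov hcov hx v 0 1
  rw [he.eq_sum hE hx (cov (e 1) x v), show (inner ℝ (e 1 x) (cov (e 1) x v) : ℝ) = 0 by linarith,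
    zero_smul, add_zero, show (inner ℝ (e 0 x) (cov (e 1) x v) : ℝ) = -connectionForm cov e x v by
      rw [connectionForm]; linarith]

/-- Vanishing torsion gives [e₀, e₁] = ∇_{e₀}e₁ − ∇_{e₁}e₀. -/
lemma IsOrthonormalFrameOn.mlieBracket_eq (he : IsOrthonormalFrameOn e W)
    (hcov : IsLeviCivita cov) (hE : Module.finrank ℝ E = 2) {x : M} (hx : x ∈ W) :
    mlieBracket I (e 0) (e 1) x = -connectionForm cov e x (e 0 x) • e 0 x
      + -connectionForm cov e x (e 1 x) • e 1 x := by
  have : IsManifold I 2 M := IsManifold.of_le (n := ∞) ENat.LEInfty.out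
  rw [← cov.torsion_eq_zero_iff.1 hcov.torsion_free (he.mdifferentiableAt 0 x)
    (he.mdifferentiableAt 1 x), he.cov_zero hcov hE hx, he.cov_one hcov hE hx,
    sub_eq_add_neg, neg_smul _ (e 1 x)]

variable [IsContMDiffRiemannianBundle I ∞ E (fun x : M ↦ TangentSpace I x)]

/-- Dual form of ∇h_± = ±√-1 ω h_±; this term is the source of the weight in `weightedDeriv`. -/
lemma IsOrthonormalFrameOn.complexCoord_cov (he : IsOrthonormalFrameOn e W)
    (hcov : IsLeviCivita cov) (hE : Module.finrank ℝ E = 2)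
    {Z : Π x : M, TangentSpace I x} (hZ : IsSmoothVectorFieldOn Z W) (b : Bool) {x : M}
    (hx : x ∈ W) (v : TangentSpace I x) :
    complexCoord e b x (cov Z x v) = mvfderiv I (fun y ↦ complexCoord e b y (Z y)) x v
      + Complex.I * boolSign b * connectionForm cov e x v * complexCoord e b x (Z x) := by
  have hd : ∀ i, MDifferentiableAt I 𝓘(ℝ, ℝ) (fun y ↦ (inner ℝ (e i y) (Z y) : ℝ)) x := fun i ↦
    ((((he.smooth i).isSmoothVectorFieldOn W).contMDiffOn_inner hZ).contMDiffAt
      (he.isOpen.mem_nhds hx)).mdifferentiableAt (by simp)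
  have hm : ∀ i, mvfderiv I (fun y ↦ (inner ℝ (e i y) (Z y) : ℝ)) x v
      = inner ℝ (cov (e i) x v) (Z x) + inner ℝ (e i x) (cov Z x v) := fun i ↦
    hcov.metric _ _ _ _ (he.mdifferentiableAt i x) (hZ.mdifferentiableAt he.isOpen hx)
  let L : ℂ → ℝ →L[ℝ] ℂ := fun c ↦ c • Complex.ofRealCLM
  have hL : ∀ c (t : ℝ), L c t = c * t := fun c t ↦ rfl
  have hfun : (fun y ↦ complexCoord e b y (Z y)) = fun y ↦
      L 2⁻¹ (inner ℝ (e 0 y) (Z y) : ℝ)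
        + L (boolSign b * Complex.I / 2) (inner ℝ (e 1 y) (Z y) : ℝ) := by
    funext y
    rw [hL, hL, complexCoord]
    ring
  have hLd : ∀ c i, MDifferentiableAt I 𝓘(ℝ, ℂ) (fun y ↦ L c (inner ℝ (e i y) (Z y) : ℝ)) x :=
    fun c i ↦ (L c).differentiable.mdifferentiable.mdifferentiableAt.comp x (hd i)
  rw [hfun, mvfderiv_fun_add (hLd _ 0) (hLd _ 1), add_apply,
    mvfderiv_clm_comp_apply _ (hd 0), mvfderiv_clm_comp_apply _ (hd 1), hm, hm,
    he.cov_zero hcov hE hx, he.cov_one hcov hE hx, inner_smul_left, inner_smul_left, hL, hL,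
    complexCoord, complexCoord]
  cases b <;> simp [boolSign] <;> ring_nf <;> simp

end MovingFrame

/-! ### Components of the iterated covariant derivatives. -/

section CovariantDerivativeComponents

variable {E : Type*} [NormedAddCommGroup E] [NormedSpace ℝ E]
  {H : Type*} [TopologicalSpace H] {I : ModelWithCorners ℝ E H}
  {M : Type*} [TopologicalSpace M] [ChartedSpace H M] [IsManifold I ∞ M]
  [RiemannianBundle (fun x : M ↦ TangentSpace I x)]
  [IsContMDiffRiemannianBundle I ∞ E (fun x : M ↦ TangentSpace I x)]
  [CompleteSpace E] [FiniteDimensional ℝ E] [T2Space M]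
  {cov : CovariantDerivative I E (fun x : M ↦ TangentSpace I x)}
  {e : Fin 2 → Π x : M, TangentSpace I x} {W : Set M}

lemma IsOrthonormalFrameOn.contMDiffOn_connectionForm (he : IsOrthonormalFrameOn e W)
    (hcov : IsLeviCivita cov) (i : Fin 2) :
    ContMDiffOn I 𝓘(ℝ, ℝ) ∞ (fun y ↦ connectionForm cov e y (e i y)) W :=
  IsSmoothVectorFieldOn.contMDiffOn_inner
    (((he.smooth 0).isSmoothVectorFieldOn W).covariantDerivative hcov.smooth he.isOpen
      ((he.smooth i).isSmoothVectorFieldOn W)) ((he.smooth 1).isSmoothVectorFieldOn W)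

lemma IsOrthonormalFrameOn.contMDiffOn_weightedDeriv (he : IsOrthonormalFrameOn e W)
    (hcov : IsLeviCivita cov) (b : Bool) (k : ℤ) {F : M → ℂ}
    (hF : ContMDiffOn I 𝓘(ℝ, ℂ) ∞ F W) :
    ContMDiffOn I 𝓘(ℝ, ℂ) ∞ (weightedDeriv cov e b k F) W := by
  have h1 : ∀ i, ContMDiffOn I 𝓘(ℝ, ℂ) ∞ (fun y ↦ mvfderiv I F y (e i y)) W := fun i ↦
    hF.mvfderiv_apply ((he.smooth i).isSmoothVectorFieldOn W) he.isOpen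
  have h2 : ∀ i, ContMDiffOn I 𝓘(ℝ, ℂ) ∞
      (fun y ↦ ((connectionForm cov e y (e i y) : ℝ) : ℂ)) W := fun i ↦
    Complex.ofRealCLM.contMDiff.comp_contMDiffOn (he.contMDiffOn_connectionForm hcov i)
  exact ((h1 0).sub (contMDiffOn_const.complex_mul (h1 1))).sub
    ((contMDiffOn_const.complex_mul ((h2 0).sub (contMDiffOn_const.complex_mul (h2 1)))).complex_mul
      hF)

lemma IsOrthonormalFrameOn.contMDiffOn_iterWeightedDeriv (he : IsOrthonormalFrameOn e W)
    (hcov : IsLeviCivita cov) {f : M → ℂ} (hf : ContMDiffOn I 𝓘(ℝ, ℂ) ∞ f W) :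
    ∀ (n : ℕ) (σ : Fin n → Bool), ContMDiffOn I 𝓘(ℝ, ℂ) ∞ (iterWeightedDeriv cov e f n σ) W
  | 0, _ => hf
  | n + 1, σ => he.contMDiffOn_weightedDeriv hcov _ _
      (he.contMDiffOn_iterWeightedDeriv hcov hf n (Fin.tail σ))

/-- The expansion of `(∇ⁿ f)(Z₁, …, Zₙ)` in the complex basis `e₀ ∓ √-1 e₁`. -/
theorem IsOrthonormalFrameOn.iterCovDeriv_eq_sum (he : IsOrthonormalFrameOn e W)
    (hcov : IsLeviCivita cov) (hE : Module.finrank ℝ E = 2) {f : M → ℂ}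
    (hf : ContMDiffOn I 𝓘(ℝ, ℂ) ∞ f W) (n : ℕ) :
    ∀ Z : Fin n → Π x : M, TangentSpace I x, (∀ i, IsSmoothVectorFieldOn (Z i) W) → ∀ x ∈ W,
      iterCovDeriv cov f n Z x
        = ∑ σ, (∏ i, complexCoord e (σ i) x (Z i x)) * iterWeightedDeriv cov e f n σ x := by
  induction n with
  | zero =>
    intro Z hZ x hx
    simp [iterCovDeriv, iterWeightedDeriv]
  | succ n ih =>
    intro Z hZ x hx
    have hWx := he.isOpen.mem_nhds hx
    have hcovZ : ∀ j : Fin n, IsSmoothVectorFieldOn (fun y ↦ cov (Z j.succ) y (Z 0 y)) W :=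
      fun j ↦ (hZ _).covariantDerivative hcov.smooth he.isOpen (hZ 0)
    have hG : ∀ σ, MDifferentiableAt I 𝓘(ℝ, ℂ) (iterWeightedDeriv cov e f n σ) x := fun σ ↦
      ((he.contMDiffOn_iterWeightedDeriv hcov hf n σ).contMDiffAt hWx).mdifferentiableAt (by simp)
    have hθ : ∀ (b : Bool) (j : Fin n), MDifferentiableAt I 𝓘(ℝ, ℂ)
        (fun y ↦ complexCoord e b y (Z j.succ y)) x := fun b j ↦
      ((he.contMDiffOn_complexCoord (hZ j.succ) b).contMDiffAt hWx).mdifferentiableAt (by simp)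
    have hθp : ∀ σ : Fin n → Bool, MDifferentiableAt I 𝓘(ℝ, ℂ)
        (fun y ↦ ∏ j, complexCoord e (σ j) y (Z j.succ y)) x := by
      intro σ
      have := MDifferentiableAt.prod (t := Finset.univ)
        (f := fun j y ↦ complexCoord e (σ j) y (Z j.succ y)) (fun j _ ↦ hθ (σ j) j)
      rwa [show (∏ j, fun y ↦ complexCoord e (σ j) y (Z j.succ y))
        = fun y ↦ ∏ j, complexCoord e (σ j) y (Z j.succ y) by ext y; simp] at this
    have hmul : ∀ σ : Fin n → Bool, MDifferentiableAt I 𝓘(ℝ, ℂ)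
        (fun y ↦ (∏ j, complexCoord e (σ j) y (Z j.succ y)) * iterWeightedDeriv cov e f n σ y) x :=
      fun σ ↦ (hθp σ).mul (hG σ)
    set w : ℂ := ((connectionForm cov e x (Z 0 x) : ℝ) : ℂ) with hw
    have hfirst : mvfderiv I (iterCovDeriv cov f n (Fin.tail Z)) x (Z 0 x)
        = ∑ σ : Fin n → Bool, ((∏ j, complexCoord e (σ j) x (Z j.succ x))
            * mvfderiv I (iterWeightedDeriv cov e f n σ) x (Z 0 x)
          + (∑ j, (∏ i ∈ Finset.univ.erase j, complexCoord e (σ i) x (Z i.succ x))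
            * mvfderiv I (fun y ↦ complexCoord e (σ j) y (Z j.succ y)) x (Z 0 x))
            * iterWeightedDeriv cov e f n σ x) := by
      have hev : iterCovDeriv cov f n (Fin.tail Z) =ᶠ[𝓝 x] fun y ↦
          ∑ σ : Fin n → Bool, (∏ j, complexCoord e (σ j) y (Z j.succ y))
            * iterWeightedDeriv cov e f n σ y := by
        filter_upwards [hWx] with y hy
        exact ih (Fin.tail Z) (fun i ↦ hZ i.succ) y hy
      rw [hev.mvfderiv_eq, mvfderiv_sum_apply _ fun σ _ ↦ hmul σ]
      refine Finset.sum_congr rfl fun σ _ ↦ ?_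
      rw [mvfderiv_mul_apply (hθp σ) (hG σ), mvfderiv_prod_apply _ fun j _ ↦ hθ (σ j) j]
    -- The derivatives of the coordinates cancel against those from the product rule in `hfirst`.
    -- What remains is √-1 ω times the sign at place `j`; summed over `j`, the signs give the
    -- weight.
    have hsecond : ∀ j : Fin n, iterCovDeriv cov f n
          (Function.update (Fin.tail Z) j (fun y ↦ cov (Z j.succ) y (Z 0 y))) x
        = ∑ σ : Fin n → Bool,
          ((∏ i ∈ Finset.univ.erase j, complexCoord e (σ i) x (Z i.succ x))
              * mvfderiv I (fun y ↦ complexCoord e (σ j) y (Z j.succ y)) x (Z 0 x)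
            + Complex.I * boolSign (σ j) * w * ∏ i, complexCoord e (σ i) x (Z i.succ x))
            * iterWeightedDeriv cov e f n σ x := by
      intro j
      rw [ih _ _ x hx]
      · refine Finset.sum_congr rfl fun σ _ ↦ ?_
        congr 1
        rw [← Finset.mul_prod_erase _ _ (Finset.mem_univ j),
          ← Finset.mul_prod_erase _ (fun i ↦ complexCoord e (σ i) x (Z i.succ x))
            (Finset.mem_univ j), Function.update_self,
          he.complexCoord_cov hcov hE (hZ j.succ) (σ j) hx]
        have : ∏ i ∈ Finset.univ.erase j, complexCoord e (σ i) x
              (Function.update (Fin.tail Z) j (fun y ↦ cov (Z j.succ) y (Z 0 y)) i x)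
            = ∏ i ∈ Finset.univ.erase j, complexCoord e (σ i) x (Z i.succ x) := by
          refine Finset.prod_congr rfl fun i hi ↦ ?_
          rw [Function.update_of_ne (Finset.ne_of_mem_erase hi)]
          rfl
        rw [this, ← hw]
        ring
      · intro i
        by_cases hij : i = j
        · subst hij
          rw [Function.update_self]
          exact hcovZ i
        · rw [Function.update_of_ne hij]
          exact hZ i.succ
    have hsplit : ∑ σ : Fin (n + 1) → Bool, (∏ i, complexCoord e (σ i) x (Z i x))
          * iterWeightedDeriv cov e f (n + 1) σ x
        = ∑ σ : Fin n → Bool, (∏ j, complexCoord e (σ j) x (Z j.succ x))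
          * ∑ b, complexCoord e b x (Z 0 x) * weightedDeriv cov e b (∑ i, boolSign (σ i))
            (iterWeightedDeriv cov e f n σ) x := by
      rw [← (Fin.consEquiv fun _ ↦ Bool).sum_comp, Fintype.sum_prod_type_right]
      refine Finset.sum_congr rfl fun σ _ ↦ ?_
      rw [Finset.mul_sum]
      refine Finset.sum_congr rfl fun b _ ↦ ?_
      rw [Fin.prod_univ_succ]
      change complexCoord e b x (Z 0 x) * (∏ j, complexCoord e (σ j) x (Z j.succ x))
        * weightedDeriv cov e b (∑ i, boolSign (σ i)) (iterWeightedDeriv cov e f n σ) x = _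
      ring
    rw [hsplit]
    change mvfderiv I (iterCovDeriv cov f n (Fin.tail Z)) x (Z 0 x)
        - ∑ j : Fin n, iterCovDeriv cov f n
            (Function.update (Fin.tail Z) j (fun y ↦ cov (Z j.succ) y (Z 0 y))) x = _
    rw [hfirst, Finset.sum_congr rfl fun j _ ↦ hsecond j, Finset.sum_comm, ← Finset.sum_sub_distrib]
    refine Finset.sum_congr rfl fun σ _ ↦ ?_
    rw [he.sum_complexCoord_mul hE hx, ← hw, ← Finset.sum_mul, Finset.sum_add_distrib,
      ← Finset.sum_mul, ← Finset.sum_mul, ← Finset.mul_sum]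
    push_cast
    ring

end CovariantDerivativeComponents

/-! ### Curvature and the commutator of the weighted derivatives. -/

section Commutator

variable {E : Type*} [NormedAddCommGroup E] [NormedSpace ℝ E]
  {H : Type*} [TopologicalSpace H] {I : ModelWithCorners ℝ E H}
  {M : Type*} [TopologicalSpace M] [ChartedSpace H M] [IsManifold I ∞ M]
  [RiemannianBundle (fun x : M ↦ TangentSpace I x)]
  [CompleteSpace E] [FiniteDimensional ℝ E] [T2Space M]
  {cov : CovariantDerivative I E (fun x : M ↦ TangentSpace I x)}
  {e : Fin 2 → Π x : M, TangentSpace I x} {W : Set M}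

/-- The structure equation: the exterior derivative of the connection form is `-K` times the
area form. -/
lemma IsOrthonormalFrameOn.structure_equation (he : IsOrthonormalFrameOn e W)
    (hcov : IsLeviCivita cov) (hE : Module.finrank ℝ E = 2) {K : ℝ}
    (hK : HasConstantSectionalCurvature cov K) {x : M} (hx : x ∈ W) :
    mvfderiv I (fun y ↦ connectionForm cov e y (e 1 y)) x (e 0 x)
      - mvfderiv I (fun y ↦ connectionForm cov e y (e 0 y)) x (e 1 x)
      = -connectionForm cov e x (e 0 x) ^ 2 - connectionForm cov e x (e 1 x) ^ 2 - K := by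
  have hs := fun i ↦ (he.smooth i).isSmoothVectorFieldOn W
  obtain ⟨h00, h11, h01⟩ := orthonormal_fin_two_iff.1 (he.orthonormal x hx)
  have hli : LinearIndependent ℝ ![e 0 x, e 1 x] := by
    rw [show ![e 0 x, e 1 x] = fun i ↦ e i x by ext i; fin_cases i <;> rfl]
    exact (he.orthonormal x hx).linearIndependent
  have h1 := hK (e 0) (e 1) (he.smooth 0) (he.smooth 1) x hli
  -- Near `x` the field ∇_{eᵢ}e₁ is −ω(eᵢ)e₀, and ∇_v e₀ is orthogonal to it, so metric
  -- compatibility leaves only the derivative of ω(eᵢ).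
  have hi : ∀ i v, (inner ℝ (cov (fun y ↦ cov (e 1) y (e i y)) x v) (e 0 x) : ℝ)
      = -mvfderiv I (fun y ↦ connectionForm cov e y (e i y)) x v := by
    intro i v
    have hm := hcov.metric (fun y ↦ cov (e 1) y (e i y)) (e 0) x v
      (((hs 1).covariantDerivative hcov.smooth he.isOpen (hs i)).mdifferentiableAt he.isOpen hx)
      (he.mdifferentiableAt 0 x)
    have hev : (fun y ↦ (inner ℝ (cov (e 1) y (e i y)) (e 0 y) : ℝ)) =ᶠ[𝓝 x]
        -fun y ↦ connectionForm cov e y (e i y) := by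
      filter_upwards [he.isOpen.mem_nhds hx] with y hy
      obtain ⟨h00, -, -⟩ := orthonormal_fin_two_iff.1 (he.orthonormal y hy)
      rw [he.cov_one hcov hE hy, inner_smul_left, h00]
      simp
    rw [hev.mvfderiv_eq, mvfderiv_neg, he.cov_zero hcov hE hx, he.cov_one hcov hE hx,
      inner_smul_left, inner_smul_right, h01] at hm
    simpa using hm.symm
  rw [sectionalCurvature, h00, h11, h01, curvature, inner_sub_left, inner_sub_left, hi, hi,
    he.cov_one hcov hE hx, he.mlieBracket_eq hcov hE hx, inner_smul_left, h00,
    connectionForm_add, connectionForm_smul, connectionForm_smul] at h1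
  simp at h1
  linarith

variable [IsContMDiffRiemannianBundle I ∞ E (fun x : M ↦ TangentSpace I x)]

lemma IsOrthonormalFrameOn.mvfderiv_weightedDeriv (he : IsOrthonormalFrameOn e W)
    (hcov : IsLeviCivita cov) {F : M → ℂ} (hF : ContMDiffOn I 𝓘(ℝ, ℂ) ∞ F W) (b : Bool) (k : ℤ)
    {x : M} (hx : x ∈ W) (v : TangentSpace I x) :
    mvfderiv I (weightedDeriv cov e b k F) x v
      = (mvfderiv I (fun y ↦ mvfderiv I F y (e 0 y)) x v
          - boolSign b * Complex.I * mvfderiv I (fun y ↦ mvfderiv I F y (e 1 y)) x v)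
        - Complex.I * k * (((connectionForm cov e x (e 0 x) : ℝ)
            - boolSign b * Complex.I * (connectionForm cov e x (e 1 x) : ℝ)) * mvfderiv I F x v
          + ((mvfderiv I (fun y ↦ connectionForm cov e y (e 0 y)) x v : ℝ)
            - boolSign b * Complex.I
              * (mvfderiv I (fun y ↦ connectionForm cov e y (e 1 y)) x v : ℝ)) * F x) := by
  have hWx := he.isOpen.mem_nhds hx
  have dF : MDifferentiableAt I 𝓘(ℝ, ℂ) F x := (hF.contMDiffAt hWx).mdifferentiableAt (by simp)
  have dA : ∀ i, MDifferentiableAt I 𝓘(ℝ, ℂ) (fun y ↦ mvfderiv I F y (e i y)) x := fun i ↦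
    ((hF.mvfderiv_apply ((he.smooth i).isSmoothVectorFieldOn W) he.isOpen).contMDiffAt
      hWx).mdifferentiableAt (by simp)
  have dC' : ∀ i, MDifferentiableAt I 𝓘(ℝ, ℝ) (fun y ↦ connectionForm cov e y (e i y)) x := fun i ↦
    ((he.contMDiffOn_connectionForm hcov i).contMDiffAt hWx).mdifferentiableAt (by simp)
  have dC : ∀ i, MDifferentiableAt I 𝓘(ℝ, ℂ)
      (fun y ↦ ((connectionForm cov e y (e i y) : ℝ) : ℂ)) x := fun i ↦
    Complex.ofRealCLM.differentiable.mdifferentiable.mdifferentiableAt.comp x (dC' i)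
  have hC : ∀ i, mvfderiv I (fun y ↦ ((connectionForm cov e y (e i y) : ℝ) : ℂ)) x v
      = (mvfderiv I (fun y ↦ connectionForm cov e y (e i y)) x v : ℝ) := fun i ↦
    mvfderiv_clm_comp_apply Complex.ofRealCLM (dC' i) v
  have dmul : ∀ {g : M → ℂ} (c : ℂ), MDifferentiableAt I 𝓘(ℝ, ℂ) g x →
      MDifferentiableAt I 𝓘(ℝ, ℂ) (fun y ↦ c * g y) x :=
    fun c hg ↦ mdifferentiableAt_const.mul hg
  have dsub : ∀ {g h : M → ℂ}, MDifferentiableAt I 𝓘(ℝ, ℂ) g x →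
      MDifferentiableAt I 𝓘(ℝ, ℂ) h x → MDifferentiableAt I 𝓘(ℝ, ℂ) (fun y ↦ g y - h y) x :=
    fun hg hh ↦ hg.sub hh
  have dCC := dsub (dC 0) (dmul (boolSign b * Complex.I) (dC 1))
  have dCF := dmul (Complex.I * k) dCC
  have dmul' : ∀ {g h : M → ℂ}, MDifferentiableAt I 𝓘(ℝ, ℂ) g x →
      MDifferentiableAt I 𝓘(ℝ, ℂ) h x → MDifferentiableAt I 𝓘(ℝ, ℂ) (fun y ↦ g y * h y) x :=
    fun hg hh ↦ hg.mul hh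
  have hsub : ∀ {g h : M → ℂ}, MDifferentiableAt I 𝓘(ℝ, ℂ) g x →
      MDifferentiableAt I 𝓘(ℝ, ℂ) h x →
      mvfderiv I (fun y ↦ g y - h y) x v = mvfderiv I g x v - mvfderiv I h x v := by
    intro g h hg hh
    rw [mvfderiv_fun_sub hg hh]
    rfl
  have h1 : weightedDeriv cov e b k F = fun y ↦
      (mvfderiv I F y (e 0 y) - boolSign b * Complex.I * mvfderiv I F y (e 1 y))
        - (Complex.I * k * ((connectionForm cov e y (e 0 y) : ℝ)
          - boolSign b * Complex.I * (connectionForm cov e y (e 1 y) : ℝ))) * F y := rfl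
  rw [h1, hsub (dsub (dA 0) (dmul _ (dA 1))) (dmul' dCF dF), hsub (dA 0) (dmul _ (dA 1)),
    mvfderiv_const_mul_apply (dA 1), mvfderiv_mul_apply dCF dF,
    mvfderiv_const_mul_apply dCC, hsub (dC 0) (dmul _ (dC 1)), mvfderiv_const_mul_apply (dC 1),
    hC, hC]
  ring

/-- The Ricci identity for the components of weight `k`. -/
theorem IsOrthonormalFrameOn.weightedDeriv_commutator (he : IsOrthonormalFrameOn e W)
    (hcov : IsLeviCivita cov) (hE : Module.finrank ℝ E = 2) {K : ℝ}
    (hK : HasConstantSectionalCurvature cov K) {F : M → ℂ} (hF : ContMDiffOn I 𝓘(ℝ, ℂ) ∞ F W)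
    (b : Bool) (k : ℤ) {x : M} (hx : x ∈ W) :
    weightedDeriv cov e b (k - boolSign b) (weightedDeriv cov e (!b) k F) x
      - weightedDeriv cov e (!b) (k + boolSign b) (weightedDeriv cov e b k F) x
      = -2 * k * boolSign b * K * F x := by
  have hbr := mvfderiv_mlieBracket he.isOpen ((he.smooth 0).isSmoothVectorFieldOn W)
    ((he.smooth 1).isSmoothVectorFieldOn W) hF hx
  rw [he.mlieBracket_eq hcov hE hx, map_add, map_smul, map_smul, Complex.real_smul,
    Complex.real_smul] at hbr
  have hst := congr_arg (fun t : ℝ ↦ (t : ℂ)) (he.structure_equation hcov hE hK hx)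
  push_cast at hst hbr
  have hexp : ∀ (b' : Bool) (k' : ℤ) (G : M → ℂ), weightedDeriv cov e b' k' G x
      = (mvfderiv I G x (e 0 x) - boolSign b' * Complex.I * mvfderiv I G x (e 1 x))
        - Complex.I * k' * ((connectionForm cov e x (e 0 x) : ℝ)
          - boolSign b' * Complex.I * (connectionForm cov e x (e 1 x) : ℝ)) * G x :=
    fun _ _ _ ↦ rfl
  -- With s the sign of `b`, the second-order terms combine to 2√-1 s (e₀e₁F − e₁e₀F), which `hbr`
  -- turns into first-order ones. The shifted outer weights k ∓ s make all first-order terms cancel,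
  -- and `hst` evaluates the derivatives of ω.
  simp only [hexp, he.mvfderiv_weightedDeriv hcov hF _ _ hx]
  cases b
  · simp only [boolSign, Bool.not_false, if_true, Bool.false_eq_true, if_false]
    push_cast
    linear_combination (norm := skip) (2 * Complex.I) * hbr + (-2 * k * F x) * hst
    ring_nf
    simp only [Complex.I_sq, Complex.I_pow_three, Complex.I_pow_four]
    ring
  · simp only [boolSign, Bool.not_true, if_true, Bool.false_eq_true, if_false]
    push_cast
    linear_combination (norm := skip) (-2 * Complex.I) * hbr + (2 * k * F x) * hst
    ring_nf
    simp only [Complex.I_sq, Complex.I_pow_three, Complex.I_pow_four]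
    ring

end Commutator

/-! ### Raising and lowering an eigenfunction. -/

section Ladder

variable {E : Type*} [NormedAddCommGroup E] [NormedSpace ℝ E]
  {H : Type*} [TopologicalSpace H] {I : ModelWithCorners ℝ E H}
  {M : Type*} [TopologicalSpace M] [ChartedSpace H M] [IsManifold I ∞ M]
  [RiemannianBundle (fun x : M ↦ TangentSpace I x)]
  {cov : CovariantDerivative I E (fun x : M ↦ TangentSpace I x)}

lemma boolSign_not (b : Bool) : boolSign (!b) = -boolSign b := by cases b <;> rfl

lemma boolSign_mul_self (b : Bool) : boolSign b * boolSign b = 1 := by cases b <;> rfl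

/-- The components `(∇ᵐ f)(e₀ ∓ √-1 e₁, …, e₀ ∓ √-1 e₁)` with all signs equal. -/
def ladder (cov : CovariantDerivative I E (fun x : M ↦ TangentSpace I x))
    (e : Fin 2 → Π x : M, TangentSpace I x) (f : M → ℂ) (b : Bool) : ℕ → M → ℂ
  | 0 => f
  | m + 1 => weightedDeriv cov e b (boolSign b * m) (ladder cov e f b m)

lemma weightedDeriv_eq_const_mul {e : Fin 2 → Π x : M, TangentSpace I x} {W : Set M}
    (hW : IsOpen W) {F G : M → ℂ} (hG : ContMDiffOn I 𝓘(ℝ, ℂ) ∞ G W) {c : ℂ}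
    (h : ∀ x ∈ W, F x = c * G x) (b : Bool) (k : ℤ) {x : M} (hx : x ∈ W) :
    weightedDeriv cov e b k F x = c * weightedDeriv cov e b k G x := by
  have hev : F =ᶠ[𝓝 x] fun y ↦ c * G y := by
    filter_upwards [hW.mem_nhds hx] with y hy using h y hy
  have hd := (hG.contMDiffAt (hW.mem_nhds hx)).mdifferentiableAt (by simp)
  rw [weightedDeriv, weightedDeriv, hev.mvfderiv_eq, mvfderiv_const_mul_apply hd,
    mvfderiv_const_mul_apply hd, h x hx]
  ring

variable [CompleteSpace E] [FiniteDimensional ℝ E] [T2Space M]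
  [IsContMDiffRiemannianBundle I ∞ E (fun x : M ↦ TangentSpace I x)]

lemma IsOrthonormalFrameOn.contMDiffOn_ladder {e : Fin 2 → Π x : M, TangentSpace I x} {W : Set M}
    (he : IsOrthonormalFrameOn e W) (hcov : IsLeviCivita cov) {f : M → ℂ}
    (hf : ContMDiffOn I 𝓘(ℝ, ℂ) ∞ f W) (b : Bool) :
    ∀ m, ContMDiffOn I 𝓘(ℝ, ℂ) ∞ (ladder cov e f b m) W
  | 0 => hf
  | m + 1 => he.contMDiffOn_weightedDeriv hcov _ _ (he.contMDiffOn_ladder hcov hf b m)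

/-- If `f` is an eigenfunction of the Laplace operator, then so are its components of equal signs,
and they can be lowered. -/
lemma IsOrthonormalFrameOn.weightedDeriv_ladder {e : Fin 2 → Π x : M, TangentSpace I x} {W : Set M}
    (he : IsOrthonormalFrameOn e W) (hcov : IsLeviCivita cov) (hE : Module.finrank ℝ E = 2) {K : ℝ}
    (hK : HasConstantSectionalCurvature cov K) {f : M → ℂ} (hf : ContMDiffOn I 𝓘(ℝ, ℂ) ∞ f W)
    {a : ℂ} (ha : ∀ x ∈ W, weightedDeriv cov e true (-1) (weightedDeriv cov e false 0 f) x = a * f x)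
    (b : Bool) (m : ℕ) : ∀ x ∈ W,
      weightedDeriv cov e (!b) (boolSign b * (m + 1 : ℕ)) (ladder cov e f b (m + 1)) x
        = (a + K * m * (m + 1)) * ladder cov e f b m x := by
  induction m with
  | zero =>
    intro x hx
    have h := he.weightedDeriv_commutator hcov hE hK hf true 0 hx
    rw [show (0 : ℤ) - boolSign true = -1 from rfl, show (0 : ℤ) + boolSign true = 1 from rfl,
      Bool.not_true, ha x hx] at h
    -- For `false` this is the hypothesis `ha`; for `true` the commutator vanishes at weight zero,
    -- so the two orders agree on `f`.
    cases b
    · simp only [ladder, boolSign]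
      simpa using ha x hx
    · simp only [ladder, boolSign]
      simp at h ⊢
      linear_combination -h
  | succ m ih =>
    intro x hx
    have hs := boolSign_mul_self b
    have hm := he.contMDiffOn_ladder hcov hf b m
    -- At weight ±(m+1) the commutator contributes 2K(m+1), and a + Km(m+1) + 2K(m+1) = a +
    -- K(m+1)(m+2).
    have h := he.weightedDeriv_commutator hcov hE hK (he.contMDiffOn_ladder hcov hf b (m + 1))
      b (boolSign b * (m + 1 : ℕ)) hx
    rw [weightedDeriv_eq_const_mul he.isOpen hm ih b _ hx,
      show boolSign b * ((m + 1 : ℕ) : ℤ) - boolSign b = boolSign b * m by push_cast; ring,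
      show boolSign b * ((m + 1 : ℕ) : ℤ) + boolSign b = boolSign b * (m + 1 + 1 : ℕ) by
        push_cast; ring] at h
    change _ * ladder cov e f b (m + 1) x
      - weightedDeriv cov e (!b) _ (ladder cov e f b (m + 1 + 1)) x = _ at h
    have hs' : (boolSign b : ℂ) * boolSign b = 1 := by exact_mod_cast hs
    push_cast at h ⊢
    linear_combination -h + 2 * (m + 1) * K * ladder cov e f b (m + 1) x * hs'

/-- All components of `∇ⁿ f` of an eigenfunction `f` are constant multiples of components of equal
signs, the constants being independent of the frame. -/
theorem exists_iterWeightedDeriv_eq (hcov : IsLeviCivita cov) (hE : Module.finrank ℝ E = 2) {K : ℝ}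
    (hK : HasConstantSectionalCurvature cov K) (f : M → ℂ) (a : ℂ) (n : ℕ) :
    ∀ σ : Fin n → Bool, ∃ (b : Bool) (m : ℕ) (c : ℂ), ∑ i, boolSign (σ i) = boolSign b * m ∧
      ∀ (e : Fin 2 → Π x : M, TangentSpace I x) (W : Set M), IsOrthonormalFrameOn e W →
        ContMDiffOn I 𝓘(ℝ, ℂ) ∞ f W →
        (∀ x ∈ W, weightedDeriv cov e true (-1) (weightedDeriv cov e false 0 f) x = a * f x) →
        ∀ x ∈ W, iterWeightedDeriv cov e f n σ x = c * ladder cov e f b m x := by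
  -- The sign, the length and the constant must be found before the frame is known, so that one
  -- constant serves all points.
  induction n with
  | zero =>
    refine fun σ ↦ ⟨true, 0, 1, by simp, fun e W _ _ _ x _ ↦ ?_⟩
    simp [iterWeightedDeriv, ladder]
  | succ n ih =>
    intro σ
    obtain ⟨b, m, c, hsum, h⟩ := ih (Fin.tail σ)
    have hsum' : ∑ i : Fin n, boolSign (σ i.succ) = boolSign b * m := hsum
    have step : ∀ (e : Fin 2 → Π x : M, TangentSpace I x) (W : Set M), IsOrthonormalFrameOn e W →
        ContMDiffOn I 𝓘(ℝ, ℂ) ∞ f W →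
        (∀ x ∈ W, weightedDeriv cov e true (-1) (weightedDeriv cov e false 0 f) x = a * f x) →
        ∀ x ∈ W, iterWeightedDeriv cov e f (n + 1) σ x
          = c * weightedDeriv cov e (σ 0) (boolSign b * m) (ladder cov e f b m) x := by
      intro e W he hf ha x hx
      rw [iterWeightedDeriv, hsum']
      exact weightedDeriv_eq_const_mul he.isOpen (he.contMDiffOn_ladder hcov hf b m)
        (h e W he hf ha) _ _ hx
    -- At `m = 0` the sign `b` carries no information and either operator raises. Otherwise the
    -- operator of sign `b` raises and the opposite one lowers.
    rcases m with - | m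
    · refine ⟨σ 0, 1, c, ?_, fun e W he hf ha x hx ↦ ?_⟩
      · rw [Fin.sum_univ_succ, hsum']
        simp
      · rw [step e W he hf ha x hx]
        simp [ladder]
    · by_cases hb : σ 0 = b
      · refine ⟨b, m + 2, c, ?_, fun e W he hf ha x hx ↦ ?_⟩
        · rw [Fin.sum_univ_succ, hsum', hb]
          push_cast
          ring
        · rw [step e W he hf ha x hx, hb]
          rfl
      · have hb' : σ 0 = !b := by
          cases h0 : σ 0 <;> cases b <;> simp_all
        refine ⟨b, m, c * (a + K * m * (m + 1)), ?_, fun e W he hf ha x hx ↦ ?_⟩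
        · rw [Fin.sum_univ_succ, hsum', hb', boolSign_not]
          push_cast
          ring
        · rw [step e W he hf ha x hx, hb', he.weightedDeriv_ladder hcov hE hK hf ha b m x hx]
          ring

end Ladder

/-! ### Evaluation on complex vectors and invariance of the Laplacian. -/

section ComplexComponents

variable {E : Type*} [NormedAddCommGroup E] [NormedSpace ℝ E]
  {H : Type*} [TopologicalSpace H] {I : ModelWithCorners ℝ E H}
  {M : Type*} [TopologicalSpace M] [ChartedSpace H M] [IsManifold I ∞ M]
  [RiemannianBundle (fun x : M ↦ TangentSpace I x)]
  [IsContMDiffRiemannianBundle I ∞ E (fun x : M ↦ TangentSpace I x)]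
  [CompleteSpace E] [FiniteDimensional ℝ E] [T2Space M]
  {cov : CovariantDerivative I E (fun x : M ↦ TangentSpace I x)}
  {e : Fin 2 → Π x : M, TangentSpace I x} {W : Set M}

lemma IsOrthonormalFrameOn.complexIterCovDerivAt_eq_sum (he : IsOrthonormalFrameOn e W)
    (hcov : IsLeviCivita cov) (hE : Module.finrank ℝ E = 2) {f : M → ℂ}
    (hf : ContMDiffOn I 𝓘(ℝ, ℂ) ∞ f W) {n : ℕ} {x : M} (hx : x ∈ W)
    (z : Fin n → ComplexTangentVector I x) :
    complexIterCovDerivAt cov f x z = ∑ σ : Fin n → Bool,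
      (∏ i, (Complex.I * complexCoord e (σ i) x (z i).im + complexCoord e (σ i) x (z i).re))
        * iterWeightedDeriv cov e f n σ x := by
  have hreal : ∀ v : Fin n → TangentSpace I x, iterCovDerivAt cov f x v
      = ∑ σ, (∏ i, complexCoord e (σ i) x (v i)) * iterWeightedDeriv cov e f n σ x := by
    intro v
    -- The fields `extend E (v i)` are known to be smooth only where the trivialization at `x` is
    -- defined.
    set W' := W ∩ (trivializationAt E (TangentSpace I) x).baseSet with hW'
    have hsub : W' ⊆ W := Set.inter_subset_left
    have he' := he.mono (he.isOpen.inter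
      (trivializationAt E (TangentSpace I) x).open_baseSet) hsub
    have := he'.iterCovDeriv_eq_sum hcov hE (hf.mono hsub) n (fun i ↦ extend E (v i))
      (fun i ↦ (isSmoothVectorFieldOn_extend (v i)).mono Set.inter_subset_right) x
      ⟨hx, FiberBundle.mem_baseSet_trivializationAt' x⟩
    rw [iterCovDerivAt]
    simpa only [extend_apply_self] using this
  rw [complexIterCovDerivAt]
  simp only [hreal, Finset.mul_sum]
  rw [Finset.sum_comm]
  refine Finset.sum_congr rfl fun σ _ ↦ ?_
  -- Multiplying out the product of binomials gives exactly the sum over the sets `S` of places with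
  -- imaginary part.
  rw [Finset.prod_add, Finset.powerset_univ, Finset.sum_mul]
  refine Finset.sum_congr rfl fun S _ ↦ ?_
  rw [Finset.prod_mul_distrib, Finset.prod_const, ← mul_assoc,
    ← Finset.prod_mul_prod_compl S fun i ↦
      complexCoord e (σ i) x (if i ∈ S then (z i).im else (z i).re), ← mul_assoc,
    Finset.compl_eq_univ_sdiff]
  congr 2
  · congr 1
    exact Finset.prod_congr rfl fun i hi ↦ by rw [if_pos hi]
  · exact Finset.prod_congr rfl fun i hi ↦ by rw [if_neg (Finset.mem_sdiff.1 hi).2]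

/-- By duality of coordinates and basis, one term of the expansion survives. -/
lemma IsOrthonormalFrameOn.complexIterCovDerivAt_hVector (he : IsOrthonormalFrameOn e W)
    (hcov : IsLeviCivita cov) (hE : Module.finrank ℝ E = 2) {f : M → ℂ}
    (hf : ContMDiffOn I 𝓘(ℝ, ℂ) ∞ f W) {n : ℕ} {x : M} (hx : x ∈ W) (σ : Fin n → Bool) :
    complexIterCovDerivAt cov f x (fun i ↦ hVector (fun j ↦ e j x) (σ i))
      = iterWeightedDeriv cov e f n σ x := by
  obtain ⟨h00, h11, h01⟩ := orthonormal_fin_two_iff.1 (he.orthonormal x hx)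
  have h10 : (inner ℝ (e 1 x) (e 0 x) : ℝ) = 0 := by rw [real_inner_comm, h01]
  have hdelta : ∀ b c : Bool,
      Complex.I * complexCoord e b x (hVector (fun j ↦ e j x) c : ComplexTangentVector I x).im
        + complexCoord e b x (hVector (fun j ↦ e j x) c : ComplexTangentVector I x).re
        = if b = c then 1 else 0 := by
    intro b c
    cases b <;> cases c <;>
      simp only [hVector, complexCoord, boolSign, inner_neg_right, h00, h11, h01, h10] <;>
      simp <;> ring_nf <;> simp <;> norm_num
  rw [he.complexIterCovDerivAt_eq_sum hcov hE hf hx, Finset.sum_eq_single σ]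
  · simp [hdelta]
  · intro τ _ hτ
    obtain ⟨i, hi⟩ := Function.ne_iff.1 hτ
    rw [Finset.prod_eq_zero (Finset.mem_univ i) (by rw [hdelta, if_neg hi]), zero_mul]
  · simp

/-- The Laplace operator in an orthonormal frame. -/
lemma IsOrthonormalFrameOn.complexIterCovDerivAt_two (he : IsOrthonormalFrameOn e W)
    (hcov : IsLeviCivita cov) (hE : Module.finrank ℝ E = 2) {K : ℝ}
    (hK : HasConstantSectionalCurvature cov K) {f : M → ℂ}
    (hf : ContMDiffOn I 𝓘(ℝ, ℂ) ∞ f W) {x : M} (hx : x ∈ W) {u : Fin 2 → TangentSpace I x}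
    (hu : Orthonormal ℝ u) :
    complexIterCovDerivAt cov f x ![hVector u true, hVector u false]
      = weightedDeriv cov e true (-1) (weightedDeriv cov e false 0 f) x := by
  obtain ⟨h00, h11, h01⟩ := orthonormal_fin_two_iff.1 (he.orthonormal x hx)
  -- Expanding the frame in the basis `u` gives the orthogonality relations of the transition
  -- matrix.
  rw [inner_eq_of_orthonormal hu hE] at h00 h11 h01
  have hsymm : ∀ i j, (inner ℝ (u i) (e j x) : ℝ) = inner ℝ (e j x) (u i) :=
    fun i j ↦ real_inner_comm _ _
  simp only [hsymm] at h00 h11 h01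
  -- At weight zero the two mixed components agree. By orthogonality their coefficients add up to 1
  -- and those of the pure components vanish, for rotations and reflections alike.
  have hc := he.weightedDeriv_commutator hcov hE hK hf true 0 hx
  rw [show (0 : ℤ) - boolSign true = -1 from rfl, show (0 : ℤ) + boolSign true = 1 from rfl,
    Bool.not_true] at hc
  have hG : ∀ b c : Bool, iterWeightedDeriv cov e f 2 ![b, c] x
      = weightedDeriv cov e b (boolSign c) (weightedDeriv cov e c 0 f) x := by
    intro b c
    simp [iterWeightedDeriv, Fin.tail]
  rw [he.complexIterCovDerivAt_eq_sum hcov hE hf hx, ← (finTwoArrowEquiv Bool).symm.sum_comp,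
    Fintype.sum_prod_type]
  simp only [finTwoArrowEquiv_symm_apply, hG, Fintype.sum_bool, Fin.prod_univ_two,
    Matrix.cons_val_zero, Matrix.cons_val_one, hVector, complexCoord, inner_neg_right]
  simp only [boolSign, if_true, Bool.false_eq_true, if_false, Int.cast_one, Int.cast_neg,
    Int.cast_zero, Complex.ofReal_neg, one_mul, neg_mul, mul_zero, zero_mul] at hc ⊢
  apply_fun ((↑) : ℝ → ℂ) at h00 h11 h01
  push_cast at h00 h11 h01
  have hI := Complex.I_mul_I
  generalize Complex.I = J at *
  generalize weightedDeriv cov e true (-1) (weightedDeriv cov e false 0 f) x = G at *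
  generalize weightedDeriv cov e false 1 (weightedDeriv cov e true 0 f) x = G' at *
  generalize weightedDeriv cov e false (-1) (weightedDeriv cov e false 0 f) x = G₁ at *
  generalize weightedDeriv cov e true 1 (weightedDeriv cov e true 0 f) x = G₂ at *
  generalize ((inner ℝ (e 0 x) (u 0) : ℝ) : ℂ) = a at *
  generalize ((inner ℝ (e 0 x) (u 1) : ℝ) : ℂ) = b at *
  generalize ((inner ℝ (e 1 x) (u 0) : ℝ) : ℂ) = c at *
  generalize ((inner ℝ (e 1 x) (u 1) : ℝ) : ℂ) = d at *
  clear hG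
  grind

end ComplexComponents

end

/-! ### The theorem. -/

theorem mainTheorem9 {M : Type*} [EMetricSpace M] [ChartedSpace (EuclideanSpace ℝ (Fin 2)) M]
    [IsManifold (𝓡 2) ∞ M]
    [RiemannianBundle (fun x : M ↦ TangentSpace (𝓡 2) x)]
    [IsContMDiffRiemannianBundle (𝓡 2) ∞ (EuclideanSpace ℝ (Fin 2))
      (fun x : M ↦ TangentSpace (𝓡 2) x)]
    [IsRiemannianManifold (𝓡 2) M] [CompleteSpace M] [ConnectedSpace M]
    (hM : IsOrientableSurface M)
    (cov : CovariantDerivative (𝓡 2) (EuclideanSpace ℝ (Fin 2))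
      (fun x : M ↦ TangentSpace (𝓡 2) x))
    (hcov : IsLeviCivita cov)
    (K : ℝ) (hK : K ≠ 0) (hcurv : HasConstantSectionalCurvature cov K)
    (p : M) (e : Fin 2 → TangentSpace (𝓡 2) p) (he : Orthonormal ℝ e)
    (X : Π q : M, Fin 2 → TangentSpace (𝓡 2) q)
    (hX : ∀ q, IsParallelTransport cov p q e (X q))
    (U : Set M) (hU : IsOpen U) (f : M → ℂ) (hf : ContMDiffOn (𝓡 2) 𝓘(ℝ, ℂ) ∞ f U)
    (h₂ : ∃ a : ℂ, ∀ q ∈ U,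
      complexIterCovDerivAt cov f q ![hVector (X q) true, hVector (X q) false] = a * f q)
    (n : ℕ) (σ : Fin n → Bool)
    (hσ : (Finset.univ.filter fun i ↦ σ i = true).card
      = (Finset.univ.filter fun i ↦ σ i = false).card) :
    ∃ b : ℂ, ∀ q ∈ U, complexIterCovDerivAt cov f q (fun i ↦ hVector (X q) (σ i)) = b * f q := by
  obtain ⟨a, ha⟩ := h₂
  have hE : Module.finrank ℝ (EuclideanSpace ℝ (Fin 2)) = 2 := by simp
  obtain ⟨b, m, c, hsum, h⟩ := exists_iterWeightedDeriv_eq hcov hE hcurv f a n σ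
  have hzero : ∑ i, boolSign (σ i) = 0 := by
    have hsign : ∀ i, boolSign (σ i) = (if σ i = true then 1 else 0)
        - (if σ i = false then 1 else 0) := fun i ↦ by cases σ i <;> rfl
    simp only [hsign, Finset.sum_sub_distrib, Finset.sum_boole, hσ, sub_self]
  have hm : m = 0 := by
    rw [hzero] at hsum
    cases b <;> simp only [boolSign] at hsum <;> grind
  subst hm
  -- `c` was obtained before `q` was chosen; only the frame below depends on `q`.
  refine ⟨c, fun q hq ↦ ?_⟩
  obtain ⟨e', W, hfr, hqW, hWU, heq⟩ := exists_isOrthonormalFrameOn hU hq ((hX q).orthonormal hcov he)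
  have hfW := hf.mono hWU
  rw [show X q = fun j ↦ e' j q from (funext heq).symm,
    hfr.complexIterCovDerivAt_hVector hcov hE hfW hqW]
  -- Away from `q` the frame need not agree with `X`, which may even be discontinuous; the Laplacian
  -- is the same in both bases.
  have hlap : ∀ x ∈ W, weightedDeriv cov e' true (-1) (weightedDeriv cov e' false 0 f) x
      = a * f x := fun x hx ↦ by
    rw [← hfr.complexIterCovDerivAt_two hcov hE hcurv hfW hx ((hX x).orthonormal hcov he),
      ha x (hWU hx)]
  simpa [ladder] using h e' W hfr hfW hlap q hqW
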